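/- Let $L$ be a language over a finite alphabet $\Sigma$ that is recognized by a (nondeterministic) one-counter automaton. Here a one-counter automaton has finitely many states and a counter holding a non-negative integer, initially $0$; in one step it may read one letter or nothing ($\varepsilon$-move), test whether the counter is zero, change the counter by $-1$, $0$ or $+1$ (never below $0$), and change its state; it accepts a word if some run that starts in the initial state and reads the whole word ends in an accepting state. Let $\mathrm{NRR}(L)$ be the regular realizability problem of the filter $L$: given a nondeterministic finite automaton $\mathcal A=(Q_{\mathcal A},\Sigma,\delta_{\mathcal A},q_0,F_{\mathcal A})$ over $\Sigma$ ($\varepsilon$-transitions allowed), described by a word that gives the number of states, the initial state, the list of accepting states and the list of transitions, with states written in unary, decide whether $L(\mathcal A)\cap L\neq\varnothing$. As a language, $\mathrm{NRR}(L)$ is the set of descriptions of all $\mathcal A$ with $L(\mathcal A)\cap L\ne\varnothing$. Then $\mathrm{NRR}(L)\in\mathbf{NL}$, that is, there is a nondeterministic Turing machine with a two-way read-only input tape and finitely many read-write work tapes that has an accepting computation exactly on the words of $\mathrm{NRR}(L)$ and that, in every computation on every input of length $n$, uses $O(\log n)$ cells of its work tapes (that is, at most $C(1+\log_2\max(n,1))$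 cells for a constant $C$ independent of the input). -/

import Mathlib

universe u v

/-! ### Nondeterministic Turing machines with a read-only input tape, and the class NL -/

/-- Head movements. -/
inductive HeadMove
  | left
  | stay
  | right

/-- The new position of a head on a tape that is infinite to the right only;
a left move in the leftmost cell has no effect. -/
def HeadMove.apply : HeadMove → ℕ → ℕ
  | left, i => i - 1
  | stay, i => i
  | right, i => i + 1

/-- What the input head may see: an input letter or one of the two end markers. -/
inductive InputSymbol (Γ : Type u)
  | leftEnd
  | letter (a : Γ)
  | rightEnd

/-- The content of cell `i` of the input tape for the input `w`: cell `0` holds the left end marker,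
cells `1, …, |w|` hold the letters of `w`, and cell `|w| + 1` holds the right end marker. -/
def readInput {Γ : Type u} (w : List Γ) : ℕ → InputSymbol Γ
  | 0 => .leftEnd
  | i + 1 => match w[i]? with
    | some a => .letter a
    | none => .rightEnd

/-- One possible action of a machine with `k` work tapes: the next state, the symbols written on the
work tapes, the movement of the input head and the movements of the heads of the work tapes. -/
structure TMAction (k : ℕ) (W S : Type) where
  state : S
  write : Fin k → W
  inputMove : HeadMove
  move : Fin k → HeadMove

/-- A nondeterministic Turing machine with input alphabet `Γ`, a two-way read-only input tape,
`k` read-write work tapes over the work alphabet `W`, and states `S`. The transition relation `next`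
lists the actions allowed for a given state, input symbol and tuple of scanned work symbols. -/
structure NTM (Γ : Type u) (k : ℕ) (W S : Type) where
  blank : W
  start : S
  accept : Set S
  next : S → InputSymbol Γ → (Fin k → W) → Set (TMAction k W S)

namespace NTM

variable {Γ : Type u} {k : ℕ} {W S : Type}

/-- Configurations of a machine on a fixed input. -/
structure Config (k : ℕ) (W S : Type) where
  state : S
  inputPos : ℕ
  tape : Fin k → ℕ → W
  head : Fin k → ℕ

/-- The initial configuration: the input head stands on the left end marker, the work tapes are
blank and their heads stand on their leftmost cells. -/
def init (M : NTM Γ k W S) : Config k W S where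
  state := M.start
  inputPos := 0
  tape := fun _ _ => M.blank
  head := fun _ => 0

/-- The configuration reached from `c` by the action `t` on the input `w`. The input head cannot
move beyond the end markers. -/
def Config.act (w : List Γ) (c : Config k W S) (t : TMAction k W S) : Config k W S where
  state := t.state
  inputPos := min (t.inputMove.apply c.inputPos) (w.length + 1)
  tape := fun i => Function.update (c.tape i) (c.head i) (t.write i)
  head := fun i => (t.move i).apply (c.head i)

/-- One computation step on the input `w`. -/
def Step (M : NTM Γ k W S) (w : List Γ) (c c' : Config k W S) : Prop :=
  ∃ t ∈ M.next c.state (readInput w c.inputPos) (fun i => c.tape i (c.head i)), c' = c.act w t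

/-- `c` occurs in some computation of `M` on the input `w`. -/
def Reachable (M : NTM Γ k W S) (w : List Γ) (c : Config k W S) : Prop :=
  Relation.ReflTransGen (M.Step w) M.init c

/-- The language of `M`: the inputs that have at least one accepting computation. -/
def accepts (M : NTM Γ k W S) : Language Γ :=
  {w | ∃ c, M.Reachable w c ∧ c.state ∈ M.accept}

/-- In every computation on the input `w`, accepting or not, every work tape head stays within the
first `s` cells of its tape. -/
def UsesSpace (M : NTM Γ k W S) (w : List Γ) (s : ℕ) : Prop :=
  ∀ c, M.Reachable w c → ∀ i, c.head i < s

end NTM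

/-- The class `NL`: languages recognized by a nondeterministic Turing machine (with finitely many
states and a finite work alphabet) in space `O(log n)` on the work tapes. -/
def InNL {Γ : Type u} [Finite Γ] (A : Language Γ) : Prop :=
  ∃ (k : ℕ) (W S : Type) (_ : Finite W) (_ : Finite S) (M : NTM Γ k W S),
    M.accepts = A ∧ ∃ C : ℕ, ∀ w : List Γ, M.UsesSpace w (C * (Nat.log 2 w.length + 1))

/-! ### Words that describe finite automata -/

/-- The alphabet of descriptions of automata over `α`. The symbol `label none` stands for `ε`. -/
inductive CodeSymbol (α : Type u)
  | tick
  | comma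
  | semicolon
  | label (a : Option α)

instance CodeSymbol.instFinite {α : Type u} [Finite α] : Finite (CodeSymbol α) := by
  let f : CodeSymbol α → Option (Option (Option (Option α)))
    | .tick => none
    | .comma => some none
    | .semicolon => some (some none)
    | .label a => some (some (some a))
  refine Finite.of_injective f ?_
  intro x y h
  cases x <;> cases y <;> simp_all [f]

/-- The number `i` in unary, terminated by a comma. -/
def unaryCode {α : Type u} (i : ℕ) : List (CodeSymbol α) :=
  List.replicate i .tick ++ [.comma]

/-- The description of the automaton with states `0, …, n - 1`, initial state `q₀`, accepting
states listed by `F` and transitions listed by `Δ` (`ε`-transitions have the label `none`). -/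
def automatonCode {α : Type u} (n : ℕ) (q₀ : Fin n) (F : List (Fin n))
    (Δ : List (Fin n × Option α × Fin n)) : List (CodeSymbol α) :=
  unaryCode n ++ unaryCode q₀ ++ F.flatMap (fun q => unaryCode q) ++ [.semicolon] ++
    Δ.flatMap (fun t => unaryCode t.1 ++ [.label t.2.1] ++ unaryCode t.2.2)

/-- `w` is a description of the automaton `A`, which has a single initial state. The accepting
states and the transitions may be listed in any order. -/
def Describes {α : Type u} {n : ℕ} (w : List (CodeSymbol α)) (A : εNFA α (Fin n)) : Prop :=
  ∃ (q₀ : Fin n) (F : List (Fin n)) (Δ : List (Fin n × Option α × Fin n)),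
    A.start = {q₀} ∧ (∀ q, q ∈ A.accept ↔ q ∈ F) ∧
    (∀ p a q, q ∈ A.step p a ↔ (p, a, q) ∈ Δ) ∧
    w = automatonCode n q₀ F Δ

/-- The regular realizability problem of the filter `L`: the set of descriptions of those
nondeterministic finite automata (`ε`-transitions allowed) whose language meets `L`. -/
def NRR {α : Type u} (L : Language α) : Language (CodeSymbol α) :=
  {w | ∃ (n : ℕ) (A : εNFA α (Fin n)), Describes w A ∧ ∃ x, x ∈ A.accepts ∧ x ∈ L}

/-! ### One-counter automata -/

/-- A nondeterministic one-counter automaton with states `Q`. `(q', d) ∈ step q a z` means that in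
state `q` the automaton may read `a` (nothing if `a = none`), add `d ∈ {-1, 0, 1}` to its counter and
go to state `q'`, provided that `z` is the outcome of the test whether the counter is zero. -/
structure OneCounterAutomaton (α : Type u) (Q : Type v) where
  step : Q → Option α → Bool → Set (Q × SignType)
  start : Q
  accept : Set Q

namespace OneCounterAutomaton

variable {α : Type u} {Q : Type v}

/-- `M.Run q m x q' m'`: `M` can go from state `q` with counter value `m` to state `q'` with counter
value `m'` while reading the word `x`. The counter value is never negative. -/
inductive Run (M : OneCounterAutomaton α Q) : Q → ℕ → List α → Q → ℕ → Prop
  | nil (q : Q) (m : ℕ) : Run M q m [] q m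
  | cons {q q₁ q' : Q} {m m₁ m' : ℕ} {a : Option α} {d : SignType} {x : List α}
      (hstep : (q₁, d) ∈ M.step q a (decide (m = 0))) (hm : (m₁ : ℤ) = (m : ℤ) + (d : ℤ))
      (hrun : Run M q₁ m₁ x q' m') : Run M q m (a.toList ++ x) q' m'

/-- The language of `M`: the words on which `M`, started with counter value `0`, can reach an
accepting state after reading the whole word. -/
def accepts (M : OneCounterAutomaton α Q) : Language α :=
  {x | ∃ q ∈ M.accept, ∃ m, M.Run M.start 0 x q m}

end OneCounterAutomaton

/-! The product of the finite automaton `A` with the one-counter automaton is a one-counter system,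
and `L(A)` meets `L` exactly when a pair of accepting states is reachable in it from the initial
pair with counter `0`. To guess such a run one stores a state of `A`, an input position and the
counter, so logarithmic space suffices once the counter is polynomially bounded.

The bound rests on `exists_balanced_succ_iff`. The relations `Balanced E k` on the set `P` of
control states increase with `k`, each arises from the preceding one by the same operator, and there
are `|P| ^ 2` pairs; hence the chain is constant from `k = |P| ^ 2` on. Excursions above a level can
therefore be replaced by excursions of at most this height. This bounds the counter quadratically
for runs that end with counter `0`; other runs are reduced to these by a further state that empties
the counter (`Drain`). Since states are written in unary, a description in which `N` distinct states
can be visited has length at least `N ^ 2 / 2`, so the bound is linear in the input length `n`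
(`Description.exists_bounded_reach`), say at most `K * (n + 1)` with a constant `K`. The remainder
of the counter modulo `K` belongs to the finite control, and the quotient is at most `n + 1`.

The algorithm is a nondeterministic program on six registers: it checks that the input is a
description and guesses an accepting state on the way, then simulates the product. Its steps only
compare numbers by equality, successor and order, which finite automata decide on binary digits. So
a step is one sweep over the work tape in which the new digits are guessed and verified. The space
bound has to hold in rejecting computations too: the list of digits grows only together with the
register `pos`, which counts scanned cells and is at most `n + 1` by `ProgramInv.pos_le`.
`SweepMachine.inNL` and `RegMachine.inNL` carry out the two translations; `ProgramInv.step` gives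
soundness of the program and `exists_computes_of_mem_NRR` its completeness. -/

/-! ### List machines: one sweep over the work tape as a single step -/

/-- A machine that stores a list over `T` and rewrites it letter by letter in every step. `begin s a`
lists the ways to start a sweep in state `s` when the input head sees `a`, `cell` is the transition
relation of the sweep, and `finish` lists the ways to end it, with an optional new last entry. -/
structure SweepMachine (Γ : Type u) (T S D : Type) where
  start : S
  accept : Set S
  begin : S → InputSymbol Γ → Set (D × HeadMove)
  cell : D → T → Set (D × T)
  finish : D → Set (S × Option T)

namespace SweepMachine

variable {Γ : Type u} {T S D : Type}

/-- `M.Sweep d l d' l'`: reading `l` from state `d`, the sweep can write `l'` and end in `d'`. -/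
inductive Sweep (M : SweepMachine Γ T S D) : D → List T → D → List T → Prop
  | nil (d : D) : Sweep M d [] d []
  | cons {d d₁ d' : D} {t t' : T} {l out : List T} (h : (d₁, t') ∈ M.cell d t)
      (hl : Sweep M d₁ l d' out) : Sweep M d (t :: l) d' (t' :: out)

/-- One step on configurations that consist of a state, an input position and a list. -/
def Step (M : SweepMachine Γ T S D) (w : List Γ) (c c' : S × ℕ × List T) : Prop :=
  ∃ d m d' l o, (d, m) ∈ M.begin c.1 (readInput w c.2.1) ∧ M.Sweep d c.2.2 d' l ∧
    (c'.1, o) ∈ M.finish d' ∧ c'.2.1 = min (m.apply c.2.1) (w.length + 1) ∧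
    c'.2.2 = l ++ o.toList

def Reachable (M : SweepMachine Γ T S D) (w : List Γ) (c : S × ℕ × List T) : Prop :=
  Relation.ReflTransGen (M.Step w) (M.start, 0, []) c

/-- The work alphabet of the simulating Turing machine: `none` is the blank and `some none` marks the
leftmost cell. -/
abbrev Symbol (T : Type) := Option (Option T)

/-- The tape with the marker followed by the list `l`. -/
def tapeOf (l : List T) : ℕ → Symbol T
  | 0 => some none
  | j + 1 => (l[j]?).map some

theorem tapeOf_append (a : List T) (t : T) (r : List T) :
    tapeOf (a ++ t :: r) (a.length + 1) = some (some t) := by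
  simp [tapeOf]

theorem tapeOf_length (a : List T) : tapeOf a (a.length + 1) = none := by
  simp [tapeOf]

theorem update_tapeOf_append (a : List T) (t t' : T) (r : List T) :
    Function.update (tapeOf (a ++ t :: r)) (a.length + 1) (some (some t')) =
      tapeOf (a ++ t' :: r) := by
  funext j
  rcases j with _ | j
  · simp [tapeOf]
  · rcases eq_or_ne j a.length with rfl | h
    · simp [tapeOf]
    · rw [Function.update_of_ne (by simpa using h)]
      simp only [tapeOf, List.getElem?_append, List.getElem?_cons]
      congr 1
      split_ifs <;> first | rfl | omega

theorem update_tapeOf_length (a : List T) (o : Option T) :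
    Function.update (tapeOf a) (a.length + 1) (o.map some) = tapeOf (a ++ o.toList) := by
  funext j
  rcases j with _ | j
  · simp [tapeOf]
  · rcases eq_or_ne j a.length with rfl | h
    · cases o <;> simp [tapeOf]
    · rw [Function.update_of_ne (by simpa using h)]
      cases o with
      | none => simp
      | some t =>
        simp only [tapeOf, List.getElem?_append, Option.toList]
        congr 1
        split_ifs with h1
        · rfl
        · rw [List.getElem?_eq_none (by omega), List.getElem?_eq_none (by simp; omega)]

/-- The Turing machine that stores the list on its work tape and performs a step by one sweep to the
right, followed by a return to the left end. -/
def toNTM (M : SweepMachine Γ T S D) : NTM Γ 1 (Symbol T) (S ⊕ D) where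
  blank := none
  start := .inl M.start
  accept := {s | ∃ s' ∈ M.accept, s = .inl s'}
  next
    | .inl s, a, r => match r 0 with
      -- Between sweeps a blank is scanned only at the very beginning; the leftmost cell then
      -- receives its marker.
      | none => {⟨.inl s, fun _ => some none, .stay, fun _ => .stay⟩}
      | some none =>
        {t | ∃ d m, (d, m) ∈ M.begin s a ∧ t = ⟨.inr d, fun _ => some none, m, fun _ => .right⟩}
      | some (some t) => {⟨.inl s, fun _ => some (some t), .stay, fun _ => .left⟩}
    | .inr d, _, r => match r 0 with
      | none => {t | ∃ s o, (s, o) ∈ M.finish d ∧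
          t = ⟨.inl s, fun _ => o.map some, .stay, fun _ => .left⟩}
      | some none => ∅
      | some (some x) => {t | ∃ d' y, (d', y) ∈ M.cell d x ∧
          t = ⟨.inr d', fun _ => some (some y), .stay, fun _ => .right⟩}

/-- The configurations that the simulating machine can be in. -/
inductive Simulates (M : SweepMachine Γ T S D) (w : List Γ) :
    NTM.Config 1 (Symbol T) (S ⊕ D) → Prop
  | init : Simulates M w M.toNTM.init
  | home {s : S} {x : ℕ} {l : List T} {j : ℕ} (h : M.Reachable w (s, x, l)) (hj : j ≤ l.length) :
      Simulates M w ⟨.inl s, x, fun _ => tapeOf l, fun _ => j⟩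
  | sweep {s : S} {x : ℕ} {l a r : List T} {d₀ d : D} {m : HeadMove}
      (h : M.Reachable w (s, x, l)) (hd : (d₀, m) ∈ M.begin s (readInput w x))
      (hl : a.length + r.length = l.length)
      -- The part already swept is recorded by its effect on continuations: whatever completes the
      -- sweep on `r` completes the sweep of all of `l`.
      (hs : ∀ d' r', M.Sweep d r d' r' → M.Sweep d₀ l d' (a ++ r')) :
      Simulates M w ⟨.inr d, min (m.apply x) (w.length + 1), fun _ => tapeOf (a ++ r),
        fun _ => a.length + 1⟩

theorem Reachable.pos_le {M : SweepMachine Γ T S D} {w : List Γ} {c : S × ℕ × List T}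
    (h : M.Reachable w c) : c.2.1 ≤ w.length + 1 := by
  induction h with
  | refl => simp
  | tail _ h _ =>
    obtain ⟨d, m, d', l, o, -, -, -, h, -⟩ := h
    omega

theorem Simulates.step {M : SweepMachine Γ T S D} {w : List Γ}
    {c c' : NTM.Config 1 (Symbol T) (S ⊕ D)} (h : M.Simulates w c) (hc : M.toNTM.Step w c c') :
    M.Simulates w c' := by
  obtain ⟨t, ht, rfl⟩ := hc
  cases h with
  | init =>
    obtain rfl : t = ⟨.inl M.start, fun _ => some none, .stay, fun _ => .stay⟩ := ht
    convert Simulates.home (M := M) (w := w) (l := []) (j := 0) .refl (by simp) using 1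
    simp only [NTM.Config.act, NTM.init, toNTM, HeadMove.apply]
    congr 1
    funext _ j
    rcases j with _ | j <;> simp [tapeOf]
  | @home s x l j h hj =>
    have hx : min x (w.length + 1) = x := min_eq_left h.pos_le
    rcases j with _ | j
    · obtain ⟨d, m, hd, rfl⟩ : ∃ d m, (d, m) ∈ M.begin s (readInput w x) ∧
          t = ⟨.inr d, fun _ => some none, m, fun _ => .right⟩ := ht
      convert Simulates.sweep (a := []) (r := l) h hd (by simp) (fun d' r' h => h) using 1
      simp only [NTM.Config.act, HeadMove.apply]
      congr 1
      funext _
      exact Function.update_eq_self 0 (tapeOf l)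
    · obtain ⟨t₀, ht₀⟩ : ∃ t₀, l[j]? = some t₀ := ⟨l[j], by simp⟩
      have hr : tapeOf l (j + 1) = some (some t₀) := by simp [tapeOf, ht₀]
      simp only [toNTM, hr] at ht
      obtain rfl : t = ⟨.inl s, fun _ => some (some t₀), .stay, fun _ => .left⟩ := ht
      convert Simulates.home (j := j) h (by omega) using 1
      simp only [NTM.Config.act, HeadMove.apply, hx]
      congr 1
      funext _
      rw [← hr]
      exact Function.update_eq_self (j + 1) (tapeOf l)
  | @sweep s x l a r d₀ d m h hd hl hs =>
    have hx : min (min (m.apply x) (w.length + 1)) (w.length + 1) =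
      min (m.apply x) (w.length + 1) := by omega
    rcases r with _ | ⟨t₀, r⟩
    · have hr : tapeOf (a ++ []) (a.length + 1) = none := by simp [tapeOf]
      simp only [toNTM, hr] at ht
      obtain ⟨s', o, ho, rfl⟩ := ht
      have h' : M.Reachable w (s', min (m.apply x) (w.length + 1), a ++ o.toList) :=
        h.tail ⟨d₀, m, d, a, o, hd, by simpa using hs d [] (.nil d), ho, rfl, rfl⟩
      convert Simulates.home (j := a.length) h' (by simp) using 1
      simp only [NTM.Config.act, HeadMove.apply]
      congr 1
      funext _
      simpa using update_tapeOf_length a o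
    · have hr := tapeOf_append a t₀ r
      simp only [toNTM, hr] at ht
      obtain ⟨d', y, hy, rfl⟩ := ht
      convert Simulates.sweep (a := a ++ [y]) (r := r) (d := d') h hd (by simp at hl ⊢; omega)
        (fun d'' r' h => by simpa using hs _ _ (.cons hy h)) using 1
      simp only [NTM.Config.act, HeadMove.apply]
      congr 1
      · funext _
        simpa using update_tapeOf_append a t₀ y r
      · simp

theorem simulates_of_reachable {M : SweepMachine Γ T S D} {w : List Γ}
    {c : NTM.Config 1 (Symbol T) (S ⊕ D)} (h : M.toNTM.Reachable w c) : M.Simulates w c := by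
  induction h with
  | refl => exact .init
  | tail _ h ih => exact ih.step h

/-- On the way back every scanned symbol is rewritten unchanged, so only the head moves. -/
theorem reachable_toNTM_home {M : SweepMachine Γ T S D} {w : List Γ} {s : S} {x : ℕ} {l : List T}
    (hx : x ≤ w.length + 1) {j : ℕ} (hj : j ≤ l.length)
    (h : M.toNTM.Reachable w ⟨.inl s, x, fun _ => tapeOf l, fun _ => j⟩) :
    M.toNTM.Reachable w ⟨.inl s, x, fun _ => tapeOf l, fun _ => 0⟩ := by
  induction j with
  | zero => exact h
  | succ j ih =>
    refine ih (by omega) (h.tail ?_)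
    have hr : tapeOf l (j + 1) = some (some l[j]) := by
      simp [tapeOf]
    refine ⟨⟨.inl s, fun _ => some (some l[j]), .stay, fun _ => .left⟩, ?_, ?_⟩
    · simp only [toNTM, hr]
      rfl
    · simp only [NTM.Config.act, HeadMove.apply, min_eq_left hx]
      congr 1
      funext _
      rw [← hr]
      exact (Function.update_eq_self (j + 1) (tapeOf l)).symm

theorem reachable_toNTM_sweep {M : SweepMachine Γ T S D} {w : List Γ} {d d' : D} {x : ℕ}
    {a r r' : List T} (hx : x ≤ w.length + 1) (hs : M.Sweep d r d' r')
    (h : M.toNTM.Reachable w ⟨.inr d, x, fun _ => tapeOf (a ++ r), fun _ => a.length + 1⟩) :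
    M.toNTM.Reachable w
      ⟨.inr d', x, fun _ => tapeOf (a ++ r'), fun _ => (a ++ r').length + 1⟩ := by
  induction hs generalizing a with
  | nil => simpa using h
  | @cons d d₁ d' t t' l l' hc _ ih =>
    have := @ih (a ++ [t']) ?_
    · simpa using this
    · refine h.tail ⟨⟨.inr d₁, fun _ => some (some t'), .stay, fun _ => .right⟩, ?_, ?_⟩
      · simp only [toNTM, tapeOf_append]
        exact ⟨d₁, t', hc, rfl⟩
      · simp only [NTM.Config.act, HeadMove.apply, min_eq_left hx]
        congr 1
        · funext _
          simpa using (update_tapeOf_append a t t' l).symm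
        · simp

theorem reachable_toNTM {M : SweepMachine Γ T S D} {w : List Γ} {c : S × ℕ × List T}
    (h : M.Reachable w c) :
    M.toNTM.Reachable w ⟨.inl c.1, c.2.1, fun _ => tapeOf c.2.2, fun _ => 0⟩ := by
  induction h with
  | refl =>
    refine .single ⟨⟨.inl M.start, fun _ => some none, .stay, fun _ => .stay⟩, rfl, ?_⟩
    simp only [NTM.Config.act, NTM.init, toNTM, HeadMove.apply]
    congr 1
    funext _ j
    rcases j with _ | j <;> simp [tapeOf]
  | @tail c c' hr h ih =>
    have hx : c.2.1 ≤ w.length + 1 := Reachable.pos_le hr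
    obtain ⟨s, x, l⟩ := c
    obtain ⟨s', x', l'⟩ := c'
    obtain ⟨d, m, d', r, o, hd, hs, ho, hx', hl'⟩ := h
    simp only at *
    subst hx' hl'
    have h1 : M.toNTM.Reachable w ⟨.inr d, min (m.apply x) (w.length + 1),
        fun _ => tapeOf ([] ++ l), fun _ => ([] : List T).length + 1⟩ := by
      refine ih.tail ⟨⟨.inr d, fun _ => some none, m, fun _ => .right⟩, ⟨d, m, hd, rfl⟩, ?_⟩
      simp only [NTM.Config.act, HeadMove.apply]
      congr 1
      funext _
      exact (Function.update_eq_self 0 (tapeOf l)).symm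
    have h2 := reachable_toNTM_sweep (by omega) hs h1
    simp only [List.nil_append] at h2
    refine reachable_toNTM_home (by omega) (j := r.length) (by simp) (h2.tail ?_)
    refine ⟨⟨.inl s', fun _ => o.map some, .stay, fun _ => .left⟩, ?_, ?_⟩
    · simp only [toNTM, tapeOf_length]
      exact ⟨s', o, ho, rfl⟩
    · simp only [NTM.Config.act, HeadMove.apply]
      congr 1
      · omega
      · funext _
        exact (update_tapeOf_length r o).symm

theorem mem_accepts_toNTM {M : SweepMachine Γ T S D} {w : List Γ} :
    w ∈ M.toNTM.accepts ↔ ∃ c, M.Reachable w c ∧ c.1 ∈ M.accept := by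
  constructor
  · rintro ⟨c, hc, s, hs, hcs⟩
    have := simulates_of_reachable hc
    cases this with
    | init => exact ⟨_, .refl, by cases hcs; exact hs⟩
    | home h _ => exact ⟨_, h, by cases hcs; exact hs⟩
    | sweep => cases hcs
  · rintro ⟨c, hc, hs⟩
    exact ⟨_, reachable_toNTM hc, _, hs, rfl⟩

/-- A language that a list machine recognizes with lists of logarithmic length belongs to `NL`. -/
theorem inNL [Finite Γ] [Finite T] [Finite S] [Finite D] (M : SweepMachine Γ T S D)
    (A : Language Γ) (hA : ∀ w, w ∈ A ↔ ∃ c, M.Reachable w c ∧ c.1 ∈ M.accept) (C : ℕ)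
    (hC : ∀ w c, M.Reachable w c → c.2.2.length ≤ C * (Nat.log 2 w.length + 1)) : InNL A := by
  -- The two additional cells are the marked one and the blank cell behind the list, where a sweep
  -- ends.
  refine ⟨1, Symbol T, S ⊕ D, inferInstance, inferInstance, M.toNTM, ?_, C + 2, ?_⟩
  · ext w
    rw [mem_accepts_toNTM, hA]
  · intro w c hc i
    have h2 : C * (Nat.log 2 w.length + 1) + 2 ≤ (C + 2) * (Nat.log 2 w.length + 1) := by
      rw [add_mul]
      omega
    have := simulates_of_reachable hc
    cases this with
    | init => simp only [NTM.init]; omega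
    | home h hj => have := hC w _ h; simp only at this ⊢; omega
    | sweep h _ hl _ => have := hC w _ h; simp only at this ⊢; omega

end SweepMachine

/-! ### Register machines whose steps are tested by finite automata on binary digits -/

/-- A constraint compares two numbers. -/
inductive Kind
  | eq
  | succ
  | lt

namespace Kind

instance : Finite Kind := by
  let f : Kind → Option Bool
    | .eq => none
    | .succ => some true
    | .lt => some false
  refine Finite.of_injective f ?_
  intro x y h
  cases x <;> cases y <;> simp_all [f]

/-- The comparison of `A` and `B`, given the state `σ` reached on the less significant digits. -/
def holds : Kind → Bool → ℕ → ℕ → Prop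
  | eq, _, A, B => A = B
  | succ, c, A, B => A + c.toNat = B
  | lt, o, A, B => A < B ∨ (A = B ∧ o = true)

/-- For `succ` the state is the carry, initially the `1` to be added; for `lt` it is the verdict on
the digits read so far, and an empty number is not less than itself. -/
def init : Kind → Bool
  | eq => true
  | succ => true
  | lt => false

def final : Kind → Bool → Prop
  | eq, _ => True
  | succ, c => c = false
  | lt, o => o = true

/-- For `lt` a more significant digit overrides the earlier verdict: if the digits differ, the first
number is smaller exactly when the second digit is `1`. -/
def next : Kind → Bool → Bool → Bool → Option Bool
  | eq, s, a, b => if a = b then some s else none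
  | succ, c, a, b => if b = xor a c then some (a && c) else none
  | lt, o, a, b => some (if a = b then o else b)

theorem holds_zero (k : Kind) (s : Bool) : k.holds s 0 0 ↔ k.final s := by
  cases k <;> cases s <;> simp [holds, final]

/-- Digits arrive with the least significant one first, so reading a pair of them reduces the
comparison to the halves `A` and `B` with an updated state. This is the induction step for all
sweeps. -/
theorem holds_digit (k : Kind) (s a b : Bool) (A B : ℕ) :
    k.holds s (a.toNat + 2 * A) (b.toNat + 2 * B) ↔
      ∃ s', k.next s a b = some s' ∧ k.holds s' A B := by
  cases k <;> cases s <;> cases a <;> cases b <;> simp [holds, next] <;> omega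

end Kind

/-- The numbers that a constraint may refer to: the contents of a register before and after the
step, and zero. -/
inductive Term (ι : Type)
  | old (i : ι)
  | new (i : ι)
  | zero

namespace Term

variable {ι : Type}

instance [Finite ι] : Finite (Term ι) := by
  let f : Term ι → Option (ι ⊕ ι)
    | .old i => some (.inl i)
    | .new i => some (.inr i)
    | .zero => none
  refine Finite.of_injective f ?_
  intro x y h
  cases x <;> cases y <;> simp_all [f]

def val (v v' : ι → ℕ) : Term ι → ℕ
  | old i => v i
  | new i => v' i
  | zero => 0

def bit (t t' : ι → Bool) : Term ι → Bool
  | old i => t i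
  | new i => t' i
  | zero => false

end Term

abbrev Constraint (ι : Type) := Kind × Term ι × Term ι

namespace Constraint

variable {ι : Type}

def holdsFrom (c : Constraint ι) (s : Bool) (v v' : ι → ℕ) : Prop :=
  c.1.holds s (c.2.1.val v v') (c.2.2.val v v')

def holds (c : Constraint ι) (v v' : ι → ℕ) : Prop :=
  c.holdsFrom c.1.init v v'

end Constraint

/-- The content of register `i`, given the list of digits, the least significant ones first. -/
def regVal {ι : Type} : List (ι → Bool) → ι → ℕ
  | [], _ => 0
  | t :: l, i => (t i).toNat + 2 * regVal l i

theorem regVal_lt {ι : Type} (l : List (ι → Bool)) (i : ι) : regVal l i < 2 ^ l.length := by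
  induction l with
  | nil => simp [regVal]
  | cons t l ih =>
    have := Bool.toNat_le (t i)
    simp only [regVal, List.length_cons, pow_succ]
    omega

theorem regVal_append_singleton {ι : Type} (l : List (ι → Bool)) (t : ι → Bool) (i : ι) :
    regVal (l ++ [t]) i = regVal l i + 2 ^ l.length * (t i).toNat := by
  induction l with
  | nil => simp [regVal]
  | cons t₀ l ih =>
    simp only [List.cons_append, regVal, ih, List.length_cons, pow_succ]
    ring

theorem exists_regVal_eq {ι : Type} (n : ℕ) (v : ι → ℕ) (hv : ∀ i, v i < 2 ^ n) :
    ∃ l : List (ι → Bool), l.length = n ∧ regVal l = v := by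
  induction n generalizing v with
  | zero => exact ⟨[], rfl, funext fun i => by have := hv i; simp [regVal] at this ⊢; omega⟩
  | succ n ih =>
    obtain ⟨l, hl, h⟩ := ih (fun i => v i / 2) (fun i => by have := hv i; rw [pow_succ] at this; omega)
    refine ⟨(fun i => decide (v i % 2 = 1)) :: l, by simp [hl], funext fun i => ?_⟩
    simp only [regVal, h]
    rcases Nat.mod_two_eq_zero_or_one (v i) with h | h <;> simp [h] <;> omega

/-- A machine with registers `ι` and states `S`. `(s', m, K) ∈ rules s a` means that in state `s`
with the input head on `a` the machine may go to `s'`, move the input head by `m` and change the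
contents of the registers in any way that meets the constraints `K`. -/
structure RegMachine (Γ : Type u) (ι S : Type) where
  start : S
  accept : Set S
  rules : S → InputSymbol Γ → Set (S × HeadMove × Set (Constraint ι))

namespace RegMachine

variable {Γ : Type u} {ι S : Type}

/-- The steps of a register machine. -/
def Step (M : RegMachine Γ ι S) (w : List Γ) (c c' : S × ℕ × (ι → ℕ)) : Prop :=
  ∃ m K, (c'.1, m, K) ∈ M.rules c.1 (readInput w c.2.1) ∧
    c'.2.1 = min (m.apply c.2.1) (w.length + 1) ∧ ∀ k ∈ K, k.holds c.2.2 c'.2.2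

def Reachable (M : RegMachine Γ ι S) (w : List Γ) (c : S × ℕ × (ι → ℕ)) : Prop :=
  Relation.ReflTransGen (M.Step w) (M.start, 0, fun _ => 0) c

/-- The list machine that stores the registers in binary. The list grows only if the register `top`
gets a nonzero leading digit. -/
def toSweep (M : RegMachine Γ ι S) (top : ι) :
    SweepMachine Γ (ι → Bool) S (S × Set (Constraint ι) × (Constraint ι → Bool)) where
  start := M.start
  accept := M.accept
  -- The rule is guessed before the sweep, which then carries the target state, the constraints and
  -- one comparison state for each constraint.
  begin s a := {e | (e.1.1, e.2, e.1.2.1) ∈ M.rules s a ∧ ∀ k, e.1.2.2 k = k.1.init}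
  cell d t := {e | e.1.1 = d.1 ∧ e.1.2.1 = d.2.1 ∧ ∀ k ∈ d.2.1,
    k.1.next (d.2.2 k) (k.2.1.bit t e.2) (k.2.2.bit t e.2) = some (e.1.2.2 k)}
  finish d := {e | e.1 = d.1 ∧ match e.2 with
    | none => ∀ k ∈ d.2.1, k.1.final (d.2.2 k)
    -- The old contents have digit zero in the new column. Without a nonzero digit of `top` the list
    -- could be padded with zeros, and the space of computations that do not accept would be
    -- unbounded.
    | some t => t top = true ∧ ∀ k ∈ d.2.1, ∃ s,
        k.1.next (d.2.2 k) (k.2.1.bit (fun _ => false) t) (k.2.2.bit (fun _ => false) t) = some s ∧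
          k.1.final s}

theorem val_cons (t t' : ι → Bool) (l l' : List (ι → Bool)) (a : Term ι) :
    a.val (regVal (t :: l)) (regVal (t' :: l')) =
      (a.bit t t').toNat + 2 * a.val (regVal l) (regVal l') := by
  cases a <;> simp [Term.val, Term.bit, regVal]

theorem val_nil (a : Term ι) : a.val (regVal []) (regVal []) = 0 := by
  cases a <;> simp [Term.val, regVal]

/-- What a sweep does, followed by the test of a property of the final digits. -/
theorem holdsFrom_of_sweep {M : RegMachine Γ ι S} {top : ι}
    {d d' : S × Set (Constraint ι) × (Constraint ι → Bool)} {l l' r r' : List (ι → Bool)}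
    (h : (M.toSweep top).Sweep d l d' l') :
    l'.length = l.length ∧ d'.1 = d.1 ∧ d'.2.1 = d.2.1 ∧
      ((∀ k ∈ d.2.1, k.holdsFrom (d'.2.2 k) (regVal r) (regVal r')) →
        ∀ k ∈ d.2.1, k.holdsFrom (d.2.2 k) (regVal (l ++ r)) (regVal (l' ++ r'))) := by
  induction h with
  | nil => exact ⟨rfl, rfl, rfl, id⟩
  | cons hc _ ih =>
    obtain ⟨h1, h2, h3⟩ := hc
    obtain ⟨i1, i2, i3, i4⟩ := ih
    refine ⟨by simp [i1], i2.trans h1, i3.trans h2, fun h k hk => ?_⟩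
    rw [h2] at i4
    rw [Constraint.holdsFrom, List.cons_append, List.cons_append, val_cons, val_cons,
      Kind.holds_digit]
    exact ⟨_, h3 k hk, i4 h k hk⟩

/-- The comparison automata are deterministic, so constraints that hold of the whole numbers dictate
their states after each digit. -/
theorem exists_sweep (M : RegMachine Γ ι S) (top : ι) (s : S) (K : Set (Constraint ι))
    (σ : Constraint ι → Bool) {l l' r r' : List (ι → Bool)} (hl : l'.length = l.length)
    (h : ∀ k ∈ K, k.holdsFrom (σ k) (regVal (l ++ r)) (regVal (l' ++ r'))) :
    ∃ σ', (M.toSweep top).Sweep (s, K, σ) l (s, K, σ') l' ∧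
      ∀ k ∈ K, k.holdsFrom (σ' k) (regVal r) (regVal r') := by
  induction l generalizing l' σ with
  | nil =>
    obtain rfl : l' = [] := by simpa using hl
    exact ⟨σ, .nil _, h⟩
  | cons t l ih =>
    obtain ⟨t', l', rfl⟩ := List.exists_cons_of_length_eq_add_one hl
    have h' : ∀ k : Constraint ι, ∃ b, k ∈ K →
        k.1.next (σ k) (k.2.1.bit t t') (k.2.2.bit t t') = some b ∧
          k.holdsFrom b (regVal (l ++ r)) (regVal (l' ++ r')) := by
      intro k
      by_cases hk : k ∈ K
      · have := h k hk
        rw [Constraint.holdsFrom, List.cons_append, List.cons_append, val_cons, val_cons,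
          Kind.holds_digit] at this
        exact this.imp fun b hb _ => hb
      -- A sweep restricts the states of constraints in `K` only; elsewhere any value will do.
      · exact ⟨true, fun h => (hk h).elim⟩
    choose σ₁ h₁ using h'
    obtain ⟨σ', h2, h3⟩ := ih σ₁ (by simpa using hl) (fun k hk => (h₁ k hk).2)
    exact ⟨σ', .cons (d₁ := (s, K, σ₁)) ⟨rfl, rfl, fun k hk => (h₁ k hk).1⟩ h2, h3⟩

theorem regVal_append_zero (l : List (ι → Bool)) : regVal (l ++ [fun _ => false]) = regVal l := by
  funext i
  simp [regVal_append_singleton]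

theorem holdsFrom_singleton (k : Constraint ι) (b : Bool) (t t' : ι → Bool) :
    k.holdsFrom b (regVal [t]) (regVal [t']) ↔
      ∃ b', k.1.next b (k.2.1.bit t t') (k.2.2.bit t t') = some b' ∧ k.1.final b' := by
  rw [Constraint.holdsFrom, val_cons, val_cons, val_nil, val_nil, Kind.holds_digit]
  simp only [Kind.holds_zero]

theorem holdsFrom_nil (k : Constraint ι) (b : Bool) :
    k.holdsFrom b (regVal []) (regVal []) ↔ k.1.final b := by
  rw [Constraint.holdsFrom, val_nil, val_nil, Kind.holds_zero]

/-- A step of the list machine is a step of the register machine. -/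
theorem step_of_toSweep_step {M : RegMachine Γ ι S} {top : ι} {w : List Γ}
    {c c' : S × ℕ × List (ι → Bool)} (h : (M.toSweep top).Step w c c') :
    M.Step w (c.1, c.2.1, regVal c.2.2) (c'.1, c'.2.1, regVal c'.2.2) ∧
      (c'.2.2.length = c.2.2.length ∨
        c'.2.2.length = c.2.2.length + 1 ∧ 2 ^ c.2.2.length ≤ regVal c'.2.2 top) := by
  obtain ⟨⟨s, K, σ⟩, m, ⟨s', K', σ'⟩, l, o, ⟨hd, hσ⟩, hs, ⟨ho1, ho2⟩, hx, hl⟩ := h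
  simp only at hd hσ ho1 ho2
  rcases o with _ | t
  · obtain ⟨h1, h2, h3, h4⟩ := holdsFrom_of_sweep (r := []) (r' := []) hs
    simp only at h2 h3 h4
    subst h2 h3
    refine ⟨⟨m, K', by rwa [ho1], hx, fun k hk => ?_⟩, .inl (by simp [hl, h1])⟩
    have := h4 (fun k hk => (holdsFrom_nil _ _).2 (ho2 k hk)) k hk
    rw [hσ k] at this
    simpa [hl, Constraint.holds] using this
  · obtain ⟨h1, h2, h3, h4⟩ := holdsFrom_of_sweep (r := [fun _ => false]) (r' := [t]) hs
    simp only at h2 h3 h4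
    subst h2 h3
    refine ⟨⟨m, K', by rwa [ho1], hx, fun k hk => ?_⟩, .inr ⟨by simp [hl, h1], ?_⟩⟩
    · have := h4 (fun k hk => (holdsFrom_singleton _ _ _ _).2 (ho2.2 k hk)) k hk
      rw [hσ k, regVal_append_zero] at this
      simpa [hl, Constraint.holds] using this
    · simp [hl, regVal_append_singleton, ho2.1, h1]

/-- Steps of a register machine that keep the contents of all registers below that of `top`, and
increase `top` by at most `1`. -/
def BoundedStep (M : RegMachine Γ ι S) (top : ι) (w : List Γ) (c c' : S × ℕ × (ι → ℕ)) : Prop :=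
  M.Step w c c' ∧ (∀ i, c'.2.2 i ≤ c'.2.2 top) ∧ c'.2.2 top ≤ c.2.2 top + 1

/-- Since `top` dominates the other registers, all of them fit into the present number of digits if
`top` does. Otherwise `top`, which grows by at most one, needs just one more digit, and that digit
is `1`, as the list machine demands. -/
theorem exists_toSweep_step {M : RegMachine Γ ι S} {top : ι} {w : List Γ}
    {c c' : S × ℕ × (ι → ℕ)} {l : List (ι → Bool)} (hl : regVal l = c.2.2)
    (h : M.BoundedStep top w c c') :
    ∃ l', regVal l' = c'.2.2 ∧ (M.toSweep top).Step w (c.1, c.2.1, l) (c'.1, c'.2.1, l') := by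
  obtain ⟨⟨m, K, hK, hx, hk⟩, hle, htop⟩ := h
  by_cases h2 : c'.2.2 top < 2 ^ l.length
  · obtain ⟨l', hl', hv⟩ := exists_regVal_eq l.length c'.2.2 (fun i => (hle i).trans_lt h2)
    refine ⟨l', hv, ?_⟩
    obtain ⟨σ, h3, h4⟩ := M.exists_sweep top c'.1 K (fun k => k.1.init) (r := []) (r' := []) hl'
      (fun k hk' => by
        have := hk k hk'
        rw [← hl, ← hv] at this
        simpa [Constraint.holds] using this)
    exact ⟨_, m, _, l', none, ⟨hK, fun _ => rfl⟩, h3,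
      ⟨rfl, fun k hk' => (holdsFrom_nil _ _).1 (h4 k hk')⟩, hx, by simp⟩
  · have h3 : c.2.2 top < 2 ^ l.length := hl ▸ regVal_lt l top
    have h4 : c'.2.2 top < 2 ^ (l.length + 1) := by
      rw [pow_succ]
      omega
    obtain ⟨l', hl', hv⟩ := exists_regVal_eq (l.length + 1) c'.2.2 (fun i => (hle i).trans_lt h4)
    obtain ⟨l₁, t, rfl⟩ : ∃ l₁ t, l' = l₁ ++ [t] := by
      rcases l'.eq_nil_or_concat with rfl | h
      · simp at hl'
      · simpa using h
    have hl₁ : l₁.length = l.length := by simpa using hl'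
    have ht : t top = true := by
      by_contra ht
      have h5 := regVal_lt l₁ top
      rw [← hv, regVal_append_singleton, hl₁] at h2
      rw [hl₁] at h5
      simp [ht] at h2
      omega
    refine ⟨l₁ ++ [t], hv, ?_⟩
    obtain ⟨σ, h5, h6⟩ := M.exists_sweep top c'.1 K (fun k => k.1.init)
      (r := [fun _ => false]) (r' := [t]) hl₁ (fun k hk' => by
        have := hk k hk'
        rw [← hl, ← hv] at this
        rwa [regVal_append_zero])
    exact ⟨_, m, _, l₁, some t, ⟨hK, fun _ => rfl⟩, h5,
      ⟨rfl, ht, fun k hk' => (holdsFrom_singleton _ _ _ _).1 (h6 k hk')⟩, hx, by simp⟩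

theorem exists_toSweep_reachable {M : RegMachine Γ ι S} {top : ι} {w : List Γ}
    {c : S × ℕ × (ι → ℕ)}
    (h : Relation.ReflTransGen (M.BoundedStep top w) (M.start, 0, fun _ => 0) c) :
    ∃ l, regVal l = c.2.2 ∧ (M.toSweep top).Reachable w (c.1, c.2.1, l) := by
  induction h with
  | refl => exact ⟨[], rfl, .refl⟩
  | tail _ h ih =>
    obtain ⟨l, hl, hr⟩ := ih
    obtain ⟨l', hl', h'⟩ := exists_toSweep_step hl h
    exact ⟨l', hl', hr.tail h'⟩

/-- A list of length `s` grows only when `top` has reached `2 ^ s`, and `top` never falls again; so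
the inequality survives every step. -/
theorem reachable_of_toSweep {M : RegMachine Γ ι S} {top : ι} {w : List Γ}
    (hmono : ∀ w c c', M.Step w c c' → c.2.2 top ≤ c'.2.2 top)
    {c : S × ℕ × List (ι → Bool)} (h : (M.toSweep top).Reachable w c) :
    M.Reachable w (c.1, c.2.1, regVal c.2.2) ∧ 2 ^ c.2.2.length ≤ 2 * regVal c.2.2 top + 1 := by
  induction h with
  | refl => exact ⟨.refl, by simp⟩
  | tail _ h ih =>
    obtain ⟨h1, h2⟩ := step_of_toSweep_step h
    have := hmono _ _ _ h1
    refine ⟨ih.1.tail h1, ?_⟩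
    rcases h2 with h2 | ⟨h2, h3⟩
    · rw [h2]
      simp only at this
      omega
    · rw [h2, pow_succ]
      omega

/-- A language belongs to `NL` if a register machine recognizes it, where `top` never decreases and is
linearly bounded, and accepting computations keep all registers below `top`. -/
theorem inNL [Finite Γ] [Finite ι] [Finite S] (M : RegMachine Γ ι S) (top : ι) (A : Language Γ)
    (hmono : ∀ w c c', M.Step w c c' → c.2.2 top ≤ c'.2.2 top)
    (htop : ∀ w c, M.Reachable w c → c.2.2 top ≤ w.length + 1)
    (hsound : ∀ w c, M.Reachable w c → c.1 ∈ M.accept → w ∈ A)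
    (hcomplete : ∀ w ∈ A, ∃ c, c.1 ∈ M.accept ∧
      Relation.ReflTransGen (M.BoundedStep top w) (M.start, 0, fun _ => 0) c) : InNL A := by
  refine (M.toSweep top).inNL A (fun w => ⟨fun hw => ?_, ?_⟩) 4 (fun w c hc => ?_)
  · obtain ⟨c, hc, hr⟩ := hcomplete w hw
    obtain ⟨l, -, hl⟩ := exists_toSweep_reachable hr
    exact ⟨_, hl, hc⟩
  · rintro ⟨c, hc, hs⟩
    exact hsound w _ (reachable_of_toSweep hmono hc).1 hs
  · obtain ⟨h1, h2⟩ := reachable_of_toSweep hmono hc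
    have h3 := htop w _ h1
    have h4 : w.length < 2 ^ (Nat.log 2 w.length + 1) := Nat.lt_pow_succ_log_self (by norm_num) _
    -- The length `s` of the list satisfies `2 ^ s ≤ 2 * (n + 1) + 1 < 8 * 2 ^ (log n + 1)`, hence
    -- `s ≤ log n + 3`, which the factor `4` covers.
    have h5 : 2 ^ c.2.2.length < 2 ^ (Nat.log 2 w.length + 1 + 3) := by
      rw [pow_add _ _ 3]
      have := Nat.one_le_two_pow (n := Nat.log 2 w.length + 1)
      simp only at h3
      omega
    have h6 := (Nat.pow_lt_pow_iff_right (by norm_num)).1 h5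
    omega

end RegMachine

/-! ### Runs of one-counter systems with a small counter -/

/-- The steps of a one-counter system with control states `P`: `E p z q d` allows to go from `p` to
`q` and to add `d` to the counter if `z` is the outcome of the zero test. -/
def CounterStep {P : Type*} (E : P → Bool → P → SignType → Prop) (c c' : P × ℕ) : Prop :=
  ∃ d, E c.1 (decide (c.2 = 0)) c'.1 d ∧ (c'.2 : ℤ) = c.2 + (d : ℤ)

/-- The steps that keep the counter below `B`. -/
def BoundedCounterStep {P : Type*} (E : P → Bool → P → SignType → Prop) (B : ℕ) (c c' : P × ℕ) :
    Prop :=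
  CounterStep E c c' ∧ c'.2 ≤ B

namespace CounterStep

open Relation

variable {P : Type*} {E : P → Bool → P → SignType → Prop}

/-- The pairs that are connected at a positive level by moving flat or by an arch over a run from
`W`. -/
def Link (E : P → Bool → P → SignType → Prop) (W : P → P → Prop) (p q : P) : Prop :=
  E p false q 0 ∨ ∃ p' q', E p false p' 1 ∧ W p' q' ∧ E q' false q (-1)

/-- The pairs connected by a run above a positive level that does not exceed it by more than `k`. -/
def Balanced (E : P → Bool → P → SignType → Prop) : ℕ → P → P → Prop
  | 0 => ReflTransGen (Link E fun _ _ => False)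
  | k + 1 => ReflTransGen (Link E (Balanced E k))

theorem Link.mono {W W' : P → P → Prop} (h : ∀ p q, W p q → W' p q) {p q : P}
    (hl : Link E W p q) : Link E W' p q :=
  hl.imp_right fun ⟨p', q', h1, h2, h3⟩ => ⟨p', q', h1, h _ _ h2, h3⟩

theorem Balanced.succ {k : ℕ} {p q : P} (h : Balanced E k p q) : Balanced E (k + 1) p q := by
  induction k generalizing p q with
  | zero => exact ReflTransGen.mono (fun _ _ => Link.mono fun _ _ => False.elim) _ _ h
  | succ k ih => exact ReflTransGen.mono (fun _ _ => Link.mono fun _ _ => ih) _ _ h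

/-- The balanced runs are exhausted at a quadratic height. -/
theorem exists_balanced_succ_iff [Fintype P] :
    ∀ p q, Balanced E (Fintype.card P ^ 2 + 1) p q ↔ Balanced E (Fintype.card P ^ 2) p q := by
  classical
  let f : ℕ → Finset (P × P) := fun k => {e | Balanced E k e.1 e.2}
  have hf : Monotone f := monotone_nat_of_le_succ fun k e he => by
    simp only [f, Finset.mem_filter_univ] at he ⊢
    exact he.succ
  have key : ∀ m, (f m).card = (f (m + 1)).card → ∀ p q, Balanced E (m + 1) p q ↔ Balanced E m p q := by
    intro m hm p q
    have := Finset.eq_of_subset_of_card_le (hf (Nat.le_succ m)) hm.ge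
    have := Finset.ext_iff.1 this (p, q)
    simpa [f] using this.symm
  refine key _ ?_
  -- The cardinalities are bounded by `|P| ^ 2`, and once two consecutive relations agree all later
  -- ones do, because each is computed from its predecessor alone.
  have := Nat.stabilises_of_monotone (f := fun k => (f k).card) (b := Fintype.card P ^ 2)
    (n := Fintype.card P ^ 2 + 1) (fun a b h => Finset.card_le_card (hf h)) (fun m => ?_)
    (fun m hm => ?_) (Nat.le_succ _)
  · exact this.symm
  · refine (Finset.card_le_univ _).trans_eq ?_
    simp [sq]
  · have h1 : Balanced E (m + 1) = Balanced E m := by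
      funext p q
      exact propext (key m hm p q)
    have h2 : Balanced E (m + 2) = Balanced E (m + 1) := by
      change ReflTransGen (Link E (Balanced E (m + 1))) = ReflTransGen (Link E (Balanced E m))
      rw [h1]
    simp only [f, h2]

/-- A balanced run is performed by a run with a small counter. -/
theorem Balanced.reflTransGen {k m B : ℕ} {p q : P} (h : Balanced E k p q) (hB : m + 1 + k ≤ B) :
    ReflTransGen (BoundedCounterStep E B) (p, m + 1) (q, m + 1) := by
  have flat : ∀ {m p q}, m + 1 ≤ B → E p false q 0 →
      ReflTransGen (BoundedCounterStep E B) (p, m + 1) (q, m + 1) := fun hm h =>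
    .single ⟨⟨0, by simpa using h, by simp⟩, hm⟩
  induction k generalizing m p q with
  | zero =>
    induction h with
    | refl => exact .refl
    | tail _ h ih =>
      rcases h with h | ⟨_, _, _, h, _⟩
      · exact ih.trans (flat (by omega) h)
      · exact h.elim
  | succ k ih =>
    induction h with
    | refl => exact .refl
    | tail _ h ih' =>
      rcases h with h | ⟨p', q', h1, h2, h3⟩
      · exact ih'.trans (flat (by omega) h)
      -- An arch is a step up, a balanced run one level higher with height budget `k`, and a step
      -- down. The sum of base level and budget is unchanged, so the same `B` serves.
      · refine ih'.trans (.head ⟨⟨1, by simpa using h1, ?_⟩, ?_⟩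
          ((ih (m := m + 1) h2 (by omega)).trans (.single ⟨⟨-1, by simpa using h3, ?_⟩, ?_⟩)))
        all_goals first | (simp; done) | (simp only; omega)

/-- The control states that can be reached with counter `m`, described by the last passages through
the levels below `m`; `W` describes the balanced runs. -/
def Level (E : P → Bool → P → SignType → Prop) (W : P → P → Prop) (a : P) : ℕ → P → Prop
  | 0 => ReflTransGen
      (fun p q => E p true q 0 ∨ ∃ p' q', E p true p' 1 ∧ W p' q' ∧ E q' false q (-1)) a
  | m + 1 => fun p => ∃ r r', Level E W a m r ∧ E r (decide (m = 0)) r' 1 ∧ W r' p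

/-- The hypothesis makes `Balanced E k` closed under arches over its own runs, so no run is too high
for it. A run is cut at its last passages upwards through the levels below the present one: a step
up opens a new level, a flat step extends the topmost balanced piece, and a step down closes an
arch. -/
theorem level_of_reflTransGen {k : ℕ}
    (hk : ∀ p q, Balanced E (k + 1) p q ↔ Balanced E k p q) {a : P} {c : P × ℕ}
    (h : ReflTransGen (CounterStep E) (a, 0) c) : Level E (Balanced E k) a c.2 c.1 := by
  have hlink : ∀ {p q r}, Balanced E k p q → Link E (Balanced E k) q r → Balanced E k p r :=
    fun h1 h2 => (hk _ _).1 (((hk _ _).2 h1).tail h2)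
  have hrefl : ∀ p, Balanced E k p p := fun p => by cases k <;> exact .refl
  induction h with
  | refl => exact .refl
  | @tail c c' _ h ih =>
    obtain ⟨p, m⟩ := c
    obtain ⟨p', m'⟩ := c'
    obtain ⟨d, hE, hm⟩ := h
    simp only at hE hm ih ⊢
    rcases m with _ | m
    · rcases d
      · obtain rfl : m' = 0 := by simpa using hm
        exact ih.tail (.inl (by simpa using hE))
      · simp at hm
      · obtain rfl : m' = 1 := by simp at hm; omega
        exact ⟨p, p', ih, by simpa using hE, hrefl _⟩
    · obtain ⟨r, r', h1, h2, h3⟩ := ih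
      replace hE : E p false p' d := by simpa using hE
      rcases d
      · obtain rfl : m' = m + 1 := by simp at hm; omega
        exact ⟨r, r', h1, h2, hlink h3 (.inl hE)⟩
      -- The topmost piece together with the step that opened it and the present step down forms one
      -- link of the level below. Level `0` is separate because there the arch starts with a
      -- successful zero test.
      · obtain rfl : m' = m := by simp at hm; omega
        rcases m' with _ | m
        · exact h1.tail (.inr ⟨r', p, by simpa using h2, h3, hE⟩)
        · obtain ⟨s, s', g1, g2, g3⟩ := h1
          exact ⟨s, s', g1, g2, hlink g3 (.inr ⟨r', p, by simpa using h2, h3, hE⟩)⟩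
      · obtain rfl : m' = m + 2 := by simp at hm; omega
        exact ⟨p, p', ⟨r, r', h1, h2, h3⟩, by simpa using hE, hrefl _⟩

/-- A run that ends with counter `0` can be replaced by one with a counter that is quadratically
bounded. -/
theorem reflTransGen_bounded_zero [Fintype P] {a b : P}
    (h : ReflTransGen (CounterStep E) (a, 0) (b, 0)) :
    ReflTransGen (BoundedCounterStep E (Fintype.card P ^ 2 + 1)) (a, 0) (b, 0) := by
  have h1 : ReflTransGen _ a b := level_of_reflTransGen exists_balanced_succ_iff h
  clear h
  induction h1 with
  | refl => exact .refl
  | tail _ h ih =>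
    rcases h with h | ⟨p', q', h1, h2, h3⟩
    · exact ih.tail ⟨⟨0, by simpa using h, by simp⟩, by simp⟩
    · refine ih.trans (.head ⟨⟨1, by simpa using h1, ?_⟩, ?_⟩
        ((h2.reflTransGen (m := 0) (B := Fintype.card P ^ 2 + 1) (by omega)).trans
          (.single ⟨⟨-1, by simpa using h3, ?_⟩, ?_⟩)))
      all_goals simp

/-- The system with an additional control state, entered from `b`, in which the counter can be
emptied. -/
def Drain (E : P → Bool → P → SignType → Prop) (b : P) :
    Option P → Bool → Option P → SignType → Prop
  | some p, z, some q, d => E p z q d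
  | some p, _, none, d => p = b ∧ d = 0
  | none, z, none, d => z = false ∧ d = -1
  | none, _, some _, _ => False

/-- A control state that can be reached at all can be reached with a quadratically bounded counter. -/
theorem reflTransGen_bounded [Fintype P] {a b : P} {m : ℕ}
    (h : ReflTransGen (CounterStep E) (a, 0) (b, m)) :
    ∃ m', ReflTransGen (BoundedCounterStep E ((Fintype.card P + 1) ^ 2 + 1)) (a, 0) (b, m') := by
  have h1 : ReflTransGen (CounterStep (Drain E b)) (some a, 0) (some b, m) :=
    h.lift (fun c => (some c.1, c.2)) fun c c' ⟨d, hd, hm⟩ => ⟨d, hd, hm⟩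
  have h2 : ∀ m, ReflTransGen (CounterStep (Drain E b)) (none, m) (none, 0) := by
    intro m
    induction m with
    | zero => exact .refl
    | succ m ih => exact .head (b := (none, m)) ⟨-1, ⟨by simp, rfl⟩, by simp⟩ ih
  have h3 := reflTransGen_bounded_zero ((h1.tail (c := (none, m)) ⟨0, ⟨rfl, rfl⟩, by simp⟩).trans (h2 m))
  rw [Fintype.card_option] at h3
  -- Until the draining state is entered, the run is one of the original system; it is entered from
  -- `b` only, and the counter at that moment is the required `m'`.
  have h4 : ∀ {c : Option P × ℕ}, ReflTransGen
      (BoundedCounterStep (Drain E b) ((Fintype.card P + 1) ^ 2 + 1)) (some a, 0) c →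
      match c.1 with
      | some p => ReflTransGen (BoundedCounterStep E ((Fintype.card P + 1) ^ 2 + 1)) (a, 0) (p, c.2)
      | none => ∃ m', ReflTransGen
          (BoundedCounterStep E ((Fintype.card P + 1) ^ 2 + 1)) (a, 0) (b, m') := by
    intro c hc
    induction hc with
    | refl => exact .refl
    | @tail c c' _ h ih =>
      obtain ⟨p, m⟩ := c
      obtain ⟨p', m'⟩ := c'
      obtain ⟨⟨d, hd, hm⟩, hB⟩ := h
      rcases p with _ | p <;> rcases p' with _ | p'
      · exact ih
      · exact hd.elim
      · obtain ⟨rfl, -⟩ := hd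
        exact ⟨m, ih⟩
      · exact ih.tail ⟨⟨d, hd, hm⟩, hB⟩
  exact h4 h3

/-- The bound in terms of the number of control states that runs can visit. -/
theorem reflTransGen_bounded_of_mem (T : Finset P) (hT : ∀ p z q d, E p z q d → p ∈ T → q ∈ T)
    {a b : P} (ha : a ∈ T) {m : ℕ} (h : ReflTransGen (CounterStep E) (a, 0) (b, m)) :
    ∃ m', ReflTransGen (BoundedCounterStep E ((T.card + 1) ^ 2 + 1)) (a, 0) (b, m') := by
  -- The run never leaves `T`, so it is a run of the system restricted to `T`, whose number of
  -- states enters the bound.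
  have h1 : ∀ {c : P × ℕ}, ReflTransGen (CounterStep E) (a, 0) c → ∃ hc : c.1 ∈ T,
      ReflTransGen (CounterStep fun (p : T) z (q : T) d => E p z q d) (⟨a, ha⟩, 0)
        (⟨c.1, hc⟩, c.2) := by
    intro c hc
    induction hc with
    | refl => exact ⟨ha, .refl⟩
    | tail _ h ih =>
      obtain ⟨d, hd, hm⟩ := h
      obtain ⟨hc, ih⟩ := ih
      exact ⟨hT _ _ _ _ hd hc, ih.tail ⟨d, hd, hm⟩⟩
  obtain ⟨hb, h2⟩ := h1 h
  obtain ⟨m', h3⟩ := reflTransGen_bounded h2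
  rw [Fintype.card_coe] at h3
  exact ⟨m', h3.lift (fun c => (c.1.1, c.2)) fun c c' ⟨⟨d, hd, hm⟩, hB⟩ => ⟨⟨d, hd, hm⟩, hB⟩⟩

end CounterStep

/-! ### The product of a finite automaton with a one-counter automaton -/

open Relation

/-- The one-counter system that runs an `εNFA` and a one-counter automaton on a common word. -/
inductive ProductStep {α : Type u} {σ Q : Type*} (A : εNFA α σ) (M : OneCounterAutomaton α Q) :
    σ × Q → Bool → σ × Q → SignType → Prop
  | eps {p p' : σ} {q : Q} {z : Bool} (h : p' ∈ A.step p none) : ProductStep A M (p, q) z (p', q) 0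
  | silent {p : σ} {q q' : Q} {z : Bool} {d : SignType} (h : (q', d) ∈ M.step q none z) :
      ProductStep A M (p, q) z (p, q') d
  | read {p p' : σ} {q q' : Q} {z : Bool} {d : SignType} {a : α} (h : p' ∈ A.step p (some a))
      (h' : (q', d) ∈ M.step q (some a) z) : ProductStep A M (p, q) z (p', q') d

namespace ProductStep

variable {α : Type u} {σ Q : Type*} {A : εNFA α σ} {M : OneCounterAutomaton α Q}

/-- The two computations are interleaved: silent moves of the one-counter automaton are made at
once, and when it is about to read a letter, the path first makes its `ε`-moves up to that letter.
At the end of the run only `ε`-moves of the path remain. -/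
theorem reflTransGen_of_isPath {p p' : σ} {q q' : Q} {m m' : ℕ} {x : List α}
    (hr : M.Run q m x q' m') {y : List (Option α)} (hy : y.reduceOption = x)
    (hp : A.IsPath p p' y) :
    ReflTransGen (CounterStep (ProductStep A M)) ((p, q), m) ((p', q'), m') := by
  induction hr generalizing p y with
  | nil q m =>
    induction hp with
    | nil => exact .refl
    | cons t s u a y h _ ih =>
      rcases a with _ | a
      · exact .head (b := ((t, q), m)) ⟨0, .eps h, by simp⟩ (ih hy)
      · simp [List.reduceOption_cons_of_some] at hy
  | @cons q q₁ q' m m₁ m' a d x hstep hm hrun ih =>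
    rcases a with _ | a
    · exact .head (b := ((p, q₁), m₁)) ⟨d, .silent hstep, hm⟩ (ih hy hp)
    · induction hp with
      | nil => simp [List.reduceOption] at hy
      | cons t s u b y h hp ih' =>
        rcases b with _ | b
        · exact .head (b := ((t, q), m)) ⟨0, .eps h, by simp⟩ (ih' ih hy)
        · simp only [List.reduceOption_cons_of_some, Option.toList_some, List.cons_append,
            List.nil_append, List.cons.injEq] at hy
          obtain ⟨rfl, hy⟩ := hy
          exact .head (b := ((t, q₁), m₁)) ⟨d, .read h hstep, hm⟩ (ih hy hp)

theorem exists_isPath {c c' : (σ × Q) × ℕ} (h : ReflTransGen (CounterStep (ProductStep A M)) c c') :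
    ∃ y, A.IsPath c.1.1 c'.1.1 y ∧ M.Run c.1.2 c.2 y.reduceOption c'.1.2 c'.2 := by
  induction h using ReflTransGen.head_induction_on with
  | refl => exact ⟨[], .nil _, .nil _ _⟩
  | @head c c₁ h _ ih =>
    obtain ⟨⟨p, q⟩, m⟩ := c
    obtain ⟨⟨p₁, q₁⟩, m₁⟩ := c₁
    obtain ⟨d, hd, hm⟩ := h
    obtain ⟨y, hy, hr⟩ := ih
    simp only at hd hm hy hr ⊢
    cases hd with
    | eps h =>
      obtain rfl : m₁ = m := by simpa using hm
      exact ⟨none :: y, .cons _ _ _ _ _ h hy, by simpa [List.reduceOption_cons_of_none] using hr⟩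
    | silent h => exact ⟨y, hy, .cons (a := none) h hm hr⟩
    | @read _ _ _ _ _ _ a h h' =>
      refine ⟨some a :: y, .cons _ _ _ _ _ h hy, ?_⟩
      rw [List.reduceOption_cons_of_some]
      exact .cons (a := some a) h' hm hr

theorem exists_mem_accepts_iff :
    (∃ x, x ∈ A.accepts ∧ x ∈ M.accepts) ↔ ∃ p₀ ∈ A.start, ∃ p ∈ A.accept, ∃ q ∈ M.accept, ∃ m,
      ReflTransGen (CounterStep (ProductStep A M)) ((p₀, M.start), 0) ((p, q), m) := by
  constructor
  · rintro ⟨x, hA, q, hq, m, hr⟩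
    obtain ⟨p₀, p, y, hp₀, hp, hy, hpath⟩ := A.mem_accepts_iff_exists_path.1 hA
    exact ⟨p₀, hp₀, p, hp, q, hq, m, reflTransGen_of_isPath hr hy hpath⟩
  · rintro ⟨p₀, hp₀, p, hp, q, hq, m, hr⟩
    obtain ⟨y, hy, hrun⟩ := exists_isPath hr
    exact ⟨y.reduceOption, A.mem_accepts_iff_exists_path.2 ⟨p₀, p, y, hp₀, hp, rfl, hy⟩, q, hq, m,
      hrun⟩

end ProductStep

/-! ### Renaming the states of a one-counter automaton -/

namespace OneCounterAutomaton

variable {α : Type u} {Q Q' : Type*}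

/-- The automaton with its states renamed. -/
def rename (M : OneCounterAutomaton α Q) (e : Q ≃ Q') : OneCounterAutomaton α Q' where
  step q a z := {t | (e.symm t.1, t.2) ∈ M.step (e.symm q) a z}
  start := e M.start
  accept := {q | e.symm q ∈ M.accept}

theorem run_rename (M : OneCounterAutomaton α Q) (e : Q ≃ Q') {q q' : Q} {m m' : ℕ} {x : List α} :
    (M.rename e).Run (e q) m x (e q') m' ↔ M.Run q m x q' m' := by
  constructor
  · have key : ∀ {r r' : Q'} {m m' x}, (M.rename e).Run r m x r' m' →
        M.Run (e.symm r) m x (e.symm r') m' := fun h => by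
      induction h with
      | nil => exact .nil _ _
      | cons hstep hm _ ih => exact .cons hstep hm ih
    intro h
    simpa using key h
  · intro h
    induction h with
    | nil => exact .nil _ _
    | cons hstep hm _ ih => exact .cons (by simpa [rename] using hstep) hm ih

theorem accepts_rename (M : OneCounterAutomaton α Q) (e : Q ≃ Q') :
    (M.rename e).accepts = M.accepts := by
  ext x
  constructor
  · rintro ⟨q, hq, m, h⟩
    refine ⟨e.symm q, hq, m, (M.run_rename e).1 ?_⟩
    simpa [rename] using h
  · rintro ⟨q, hq, m, h⟩
    exact ⟨e q, by simpa [rename] using hq, m, (M.run_rename e).2 h⟩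

end OneCounterAutomaton

/-! ### Descriptions -/

/-- The code of a list of states. -/
def stateListCode {α : Type u} (F : List ℕ) : List (CodeSymbol α) :=
  F.flatMap fun q => unaryCode q

/-- The code of a list of transitions. -/
def transitionListCode {α : Type u} (Δ : List (ℕ × Option α × ℕ)) : List (CodeSymbol α) :=
  Δ.flatMap fun t => unaryCode t.1 ++ [.label t.2.1] ++ unaryCode t.2.2

/-- The data listed in the description of an automaton. -/
structure Description (α : Type u) where
  n : ℕ
  start : Fin n
  accept : List (Fin n)
  transitions : List (Fin n × Option α × Fin n)

namespace Description

variable {α : Type u}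

def natAccept (D : Description α) : List ℕ := D.accept.map Fin.val

def natTransitions (D : Description α) : List (ℕ × Option α × ℕ) :=
  D.transitions.map fun t => (t.1, t.2.1, t.2.2)

/-- The part of the code up to the semicolon. -/
def head (D : Description α) : List (CodeSymbol α) :=
  unaryCode D.n ++ unaryCode D.start ++ stateListCode D.natAccept

def code (D : Description α) : List (CodeSymbol α) :=
  D.head ++ .semicolon :: transitionListCode D.natTransitions

def toNFA (D : Description α) : εNFA α (Fin D.n) where
  step p a := {q | (p, a, q) ∈ D.transitions}
  start := {D.start}
  accept := {q | q ∈ D.accept}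

/-- A description fixes all components of the automaton, so it is enough to quantify over the listed
data. -/
theorem mem_NRR_iff {L : Language α} {w : List (CodeSymbol α)} :
    w ∈ NRR L ↔ ∃ D : Description α, w = D.code ∧ ∃ x, x ∈ D.toNFA.accepts ∧ x ∈ L := by
  have hcode : ∀ D : Description α,
      D.code = automatonCode D.n D.start D.accept D.transitions := fun D => by
    simp [code, head, automatonCode, stateListCode, transitionListCode, natAccept, natTransitions,
      List.flatMap_map, List.flatMap_assoc]
  constructor
  · rintro ⟨n, A, ⟨q₀, F, Δ, h1, h2, h3, rfl⟩, hx⟩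
    refine ⟨⟨n, q₀, F, Δ⟩, (hcode ⟨n, q₀, F, Δ⟩).symm, ?_⟩
    have : A = toNFA ⟨n, q₀, F, Δ⟩ := by
      obtain ⟨step, start, accept⟩ := A
      simp only [toNFA, εNFA.mk.injEq]
      refine ⟨?_, h1, Set.ext h2⟩
      funext p a
      exact Set.ext fun q => h3 p a q
    rwa [← this]
  · rintro ⟨D, rfl, hx⟩
    exact ⟨D.n, D.toNFA, ⟨D.start, D.accept, D.transitions, rfl, fun _ => Iff.rfl,
      fun _ _ _ => Iff.rfl, hcode D⟩, hx⟩

/-- The states that can be visited. -/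
def visited (D : Description α) : List (Fin D.n) :=
  D.start :: D.transitions.map fun t => t.2.2

theorem sum_toFinset_le (l : List ℕ) : ∑ i ∈ l.toFinset, (i + 1) ≤ (l.map (· + 1)).sum := by
  induction l with
  | nil => simp
  | cons a l ih =>
    rw [List.toFinset_cons, List.map_cons, List.sum_cons]
    by_cases h : a ∈ l.toFinset
    · rw [Finset.insert_eq_of_mem h]
      omega
    · rw [Finset.sum_insert h]
      omega

/-- The `i`-th smallest of distinct natural numbers is at least `i - 1`. In the induction the new
maximum is at least the number of earlier elements, which pays for the growth of the square. -/
theorem card_sq_le (s : Finset ℕ) : s.card ^ 2 ≤ 2 * ∑ i ∈ s, (i + 1) := by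
  induction s using Finset.induction_on_max with
  | empty => simp
  | insert a s h ih =>
    have ha : a ∉ s := fun ha => (h a ha).false
    have hs : s.card ≤ a := by
      simpa using Finset.card_le_card (fun x hx => Finset.mem_range.2 (h x hx) : s ⊆ Finset.range a)
    rw [Finset.card_insert_of_notMem ha, Finset.sum_insert ha]
    nlinarith

/-- As states are written in unary, the square of their number is linear in the length. -/
theorem card_visited_sq_le (D : Description α) : D.visited.toFinset.card ^ 2 ≤ 2 * D.code.length := by
  have h1 : D.visited.toFinset.card = (D.visited.map Fin.val).toFinset.card := by
    have : (D.visited.map Fin.val).toFinset = D.visited.toFinset.image Fin.val := by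
      ext
      simp
    rw [this, Finset.card_image_of_injective _ Fin.val_injective]
  rw [h1]
  refine (card_sq_le _).trans (Nat.mul_le_mul_left 2 ((sum_toFinset_le _).trans ?_))
  -- A transition to state `i` contributes `i` ticks and a comma for its target alone.
  have h2 : ∀ l : List (Fin D.n × Option α × Fin D.n),
      (l.map fun t => (t.2.2 : ℕ) + 1).sum ≤
        (transitionListCode (l.map fun t => ((t.1 : ℕ), t.2.1, (t.2.2 : ℕ)))).length := by
    intro l
    induction l with
    | nil => simp
    | cons t l ih =>
      simp [transitionListCode, unaryCode] at ih ⊢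
      omega
  have h3 := h2 D.transitions
  simp [visited, code, head, unaryCode, natTransitions, Function.comp_def] at h3 ⊢
  omega

/-- The configurations that the product with a one-counter automaton can reach. -/
def Reach (D : Description α) {Q : Type*} (M : OneCounterAutomaton α Q) (p : Fin D.n) (q : Q)
    (m : ℕ) : Prop :=
  ReflTransGen (CounterStep (ProductStep D.toNFA M)) ((D.start, M.start), 0) ((p, q), m)

theorem mem_NRR_of_reach {Q : Type*} {M : OneCounterAutomaton α Q} {D : Description α} {p : Fin D.n}
    {q : Q} {m : ℕ} (hp : p ∈ D.accept) (hq : q ∈ M.accept) (h : D.Reach M p q m) :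
    D.code ∈ NRR M.accepts :=
  mem_NRR_iff.2 ⟨D, rfl,
    ProductStep.exists_mem_accepts_iff.2 ⟨D.start, rfl, p, hp, q, hq, m, h⟩⟩

/-- If the automaton meets the filter, then there is an accepting run of the product with a linearly
bounded counter. -/
theorem exists_bounded_reach {Q : Type*} [Fintype Q] {M : OneCounterAutomaton α Q}
    {w : List (CodeSymbol α)} (hw : w ∈ NRR M.accepts) :
    ∃ D : Description α, w = D.code ∧ ∃ p ∈ D.accept, ∃ q ∈ M.accept, ∃ m,
      ReflTransGen (BoundedCounterStep (ProductStep D.toNFA M)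
        ((4 * Fintype.card Q ^ 2 + 3) * (w.length + 1)))
        ((D.start, M.start), 0) ((p, q), m) := by
  classical
  obtain ⟨D, rfl, hx⟩ := mem_NRR_iff.1 hw
  obtain ⟨p₀, rfl, p, hp, q, hq, m, h⟩ := ProductStep.exists_mem_accepts_iff.1 hx
  obtain ⟨m', h'⟩ := CounterStep.reflTransGen_bounded_of_mem
    -- Only the initial state and targets of transitions can be visited; the number `n` of states is
    -- itself linear in the length, which would give merely a quadratic bound.
    (D.visited.toFinset ×ˢ (Finset.univ : Finset Q)) (fun c z c' d hc h => by
      cases hc with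
      | eps hs => simpa [visited] using .inr ⟨_, _, hs⟩
      | silent hs => simpa using h
      | read hs _ => simpa [visited] using .inr ⟨_, _, hs⟩) (by simp [visited]) h
  refine ⟨D, rfl, p, hp, q, hq, m', ReflTransGen.mono (fun c c' hc => ⟨hc.1, hc.2.trans ?_⟩) _ _ h'⟩
  have h1 := D.card_visited_sq_le
  rw [Finset.card_product, Finset.card_univ]
  generalize D.visited.toFinset.card = s at *
  generalize D.code.length = l at *
  generalize Fintype.card Q = k
  -- With `s ^ 2 ≤ 2 * l` one gets `(s * k + 1) ^ 2 + 1 ≤ 2 * (s * k) ^ 2 + 3 ≤ 4 * k ^ 2 * l + 3`,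
  -- whence the constant `4 * k ^ 2 + 3`.
  have h2 : s ^ 2 * k ^ 2 ≤ 2 * l * k ^ 2 := Nat.mul_le_mul_right _ h1
  have h3 : 2 * (s * k) ≤ (s * k) ^ 2 + 1 := by
    zify
    nlinarith [sq_nonneg ((s * k : ℤ) - 1)]
  nlinarith

end Description

/-! ### The program -/

section Program

/-- The registers: the number of scanned cells, the number of states, the current state, an accepting
state, the length of the current block of ticks, and the quotient of the counter by a constant. -/
inductive Reg
  | pos
  | size
  | cur
  | goal
  | count
  | ctr

instance : Finite Reg := by
  let f : Reg → Fin 6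
    | .pos => 0
    | .size => 1
    | .cur => 2
    | .goal => 3
    | .count => 4
    | .ctr => 5
  refine Finite.of_injective f ?_
  intro x y h
  cases x <;> cases y <;> simp_all [f]

theorem Reg.forall_iff {p : Reg → Prop} :
    (∀ i, p i) ↔ p pos ∧ p size ∧ p cur ∧ p goal ∧ p count ∧ p ctr :=
  ⟨fun h => ⟨h _, h _, h _, h _, h _, h _⟩, fun ⟨h1, h2, h3, h4, h5, h6⟩ i => by
    cases i <;> assumption⟩

/-- The ways to change a register. -/
inductive Update
  | keep
  | zero
  | inc
  | dec
  | copy (j : Reg)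

namespace Update

def constraint (i : Reg) : Update → Constraint Reg
  | keep => (.eq, .old i, .new i)
  | zero => (.eq, .zero, .new i)
  | inc => (.succ, .old i, .new i)
  -- The successor relation read backwards; it cannot be met when the register contains `0`.
  | dec => (.succ, .new i, .old i)
  | copy j => (.eq, .old j, .new i)

def holds (u : Update) (i : Reg) (v v' : Reg → ℕ) : Prop := (u.constraint i).holds v v'

variable {i j : Reg} {v v' : Reg → ℕ}

theorem holds_keep : keep.holds i v v' ↔ v' i = v i := eq_comm

theorem holds_zero : zero.holds i v v' ↔ v' i = 0 := eq_comm

theorem holds_inc : inc.holds i v v' ↔ v' i = v i + 1 := eq_comm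

theorem holds_dec : dec.holds i v v' ↔ v' i + 1 = v i := Iff.rfl

theorem holds_copy : (copy j).holds i v v' ↔ v' i = v j := eq_comm

end Update

def updates (x n p g c r : Update) : Reg → Update
  | .pos => x
  | .size => n
  | .cur => p
  | .goal => g
  | .count => c
  | .ctr => r

theorem forall_updates_holds {x n p g c r : Update} {v v' : Reg → ℕ} :
    (∀ i, (updates x n p g c r i).holds i v v') ↔ x.holds .pos v v' ∧ n.holds .size v v' ∧
      p.holds .cur v v' ∧ g.holds .goal v v' ∧ c.holds .count v v' ∧ r.holds .ctr v v' :=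
  Reg.forall_iff

namespace Constraint

def isZero (i : Reg) : Constraint Reg := (.eq, .old i, .zero)

def isPos (i : Reg) : Constraint Reg := (.lt, .zero, .old i)

def isLt (i j : Reg) : Constraint Reg := (.lt, .old i, .old j)

def isEq (i j : Reg) : Constraint Reg := (.eq, .old i, .old j)

variable {i j : Reg} {v v' : Reg → ℕ}

theorem holds_isZero : (isZero i).holds v v' ↔ v i = 0 := Iff.rfl

theorem holds_isPos : (isPos i).holds v v' ↔ 0 < v i := by
  simp [isPos, holds, holdsFrom, Kind.holds, Kind.init, Term.val]

theorem holds_isLt : (isLt i j).holds v v' ↔ v i < v j := by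
  simp [isLt, holds, holdsFrom, Kind.holds, Kind.init, Term.val]

theorem holds_isEq : (isEq i j).holds v v' ↔ v i = v j := Iff.rfl

end Constraint

/-! ### A counter split into quotient and remainder -/

open Constraint Update

/-- The tests by which the counter `K * ctr + ρ` is compared with zero. -/
inductive ZeroTest {K : ℕ} : Bool → Fin K → List (Constraint Reg) → Prop
  | zero {ρ : Fin K} (h : ρ.val = 0) : ZeroTest true ρ [isZero .ctr]
  | remainder {ρ : Fin K} (h : 0 < ρ.val) : ZeroTest false ρ []
  | quotient {ρ : Fin K} : ZeroTest false ρ [isPos .ctr]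

theorem ZeroTest.eq_decide {K : ℕ} {z : Bool} {ρ : Fin K} {ts : List (Constraint Reg)}
    (h : ZeroTest z ρ ts) {v v' : Reg → ℕ} (hts : ∀ t ∈ ts, t.holds v v') :
    z = decide (K * v .ctr + ρ = 0) := by
  have hK := ρ.pos
  cases h with
  | zero h =>
    have h1 := holds_isZero.1 (hts (isZero .ctr) (by simp))
    simp [h, h1]
  | remainder h =>
    simp only [Bool.false_eq, decide_eq_false_iff_not]
    omega
  | quotient =>
    have h1 := holds_isPos.1 (hts (isPos .ctr) (by simp))
    have := Nat.mul_pos hK h1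
    simp only [Bool.false_eq, decide_eq_false_iff_not]
    omega

theorem ZeroTest.exists_of_eq_decide {K : ℕ} {ρ : Fin K} {v v' : Reg → ℕ} {m : ℕ}
    (hm : m = K * v .ctr + ρ) :
    ∃ ts, ZeroTest (decide (m = 0)) ρ ts ∧ ∀ t ∈ ts, t.holds v v' := by
  have hK := ρ.pos
  rcases Nat.eq_zero_or_pos (v .ctr) with h | h
  · rcases Nat.eq_zero_or_pos ρ.val with h' | h'
    · refine ⟨[isZero .ctr], ?_, by simpa using holds_isZero.2 h⟩
      simpa [hm, h, h'] using ZeroTest.zero h'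
    · refine ⟨[], ?_, by simp⟩
      simpa [hm, h, h'.ne'] using ZeroTest.remainder h'
  · refine ⟨[isPos .ctr], ?_, by simpa using holds_isPos.2 h⟩
    have : m ≠ 0 := by
      have := Nat.mul_pos hK h
      omega
    simpa [this] using ZeroTest.quotient (ρ := ρ)

/-- The changes of the counter `K * ctr + ρ`. -/
inductive CounterUpdate {K : ℕ} : SignType → Fin K → Fin K → Update → Prop
  | zero {ρ : Fin K} : CounterUpdate 0 ρ ρ .keep
  | pos {ρ ρ' : Fin K} (h : ρ'.val = ρ.val + 1) : CounterUpdate 1 ρ ρ' .keep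
  | carry {ρ ρ' : Fin K} (h : ρ.val + 1 = K) (h' : ρ'.val = 0) : CounterUpdate 1 ρ ρ' .inc
  | neg {ρ ρ' : Fin K} (h : ρ.val = ρ'.val + 1) : CounterUpdate (-1) ρ ρ' .keep
  | borrow {ρ ρ' : Fin K} (h : ρ.val = 0) (h' : ρ'.val + 1 = K) : CounterUpdate (-1) ρ ρ' .dec

theorem CounterUpdate.counter_eq {K : ℕ} {d : SignType} {ρ ρ' : Fin K} {u : Update}
    (h : CounterUpdate d ρ ρ' u) {v v' : Reg → ℕ} (hu : u.holds .ctr v v') :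
    ((K * v' .ctr + ρ' : ℕ) : ℤ) = (K * v .ctr + ρ : ℕ) + (d : ℤ) := by
  cases h with
  | zero =>
    rw [holds_keep.1 hu]
    simp
  | pos h =>
    rw [holds_keep.1 hu, h]
    simp [add_assoc]
  | carry h h' =>
    have hK : (K : ℤ) = ρ + 1 := by exact_mod_cast h.symm
    rw [holds_inc.1 hu, h']
    push_cast
    simp only [SignType.coe_one]
    linear_combination hK
  | neg h =>
    rw [holds_keep.1 hu, h]
    simp
    ring
  | borrow h h' =>
    have hK : (K : ℤ) = ρ' + 1 := by exact_mod_cast h'.symm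
    rw [← holds_dec.1 hu, h]
    push_cast
    simp only [SignType.coe_one]
    linear_combination -hK

/-- By uniqueness of division with remainder, adding one either increases the remainder or, if it is
`K - 1`, resets it and carries into the quotient; subtracting one is the same with the two sides
exchanged. -/
theorem CounterUpdate.exists_of_counter_eq {K : ℕ} {d : SignType} {ρ ρ' : Fin K} {v v' : Reg → ℕ}
    (h : ((K * v' .ctr + ρ' : ℕ) : ℤ) = (K * v .ctr + ρ : ℕ) + (d : ℤ)) :
    ∃ u, CounterUpdate d ρ ρ' u ∧ u.holds .ctr v v' := by
  have key : ∀ {a c b e : ℕ}, b < K → e < K → K * a + b = K * c + e → a = c ∧ b = e := by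
    intro a c b e hb he h
    have h1 := congrArg (· / K) h
    have h2 := congrArg (· % K) h
    simp only [Nat.mul_add_div hb.pos, Nat.div_eq_of_lt hb, Nat.div_eq_of_lt he, add_zero] at h1
    simp only [Nat.mul_add_mod, Nat.mod_eq_of_lt hb, Nat.mod_eq_of_lt he] at h2
    exact ⟨h1, h2⟩
  have step : ∀ {a c : ℕ} {b e : Fin K}, K * a + b = K * c + e + 1 →
      (a = c ∧ b.val = e.val + 1) ∨ (a = c + 1 ∧ e.val + 1 = K ∧ b.val = 0) := by
    intro a c b e h
    rcases Nat.lt_or_ge (e.val + 1) K with he | he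
    · exact .inl (key b.2 he h)
    · have he' : e.val + 1 = K := by omega
      have := key (e := 0) b.2 b.pos (h.trans (by rw [add_assoc, he']; ring : _ = K * (c + 1) + 0))
      exact .inr ⟨this.1, he', this.2⟩
  rcases d
  · obtain ⟨h1, h2⟩ := key (a := v' .ctr) (c := v .ctr) ρ'.2 ρ.2 (by simp at h; omega)
    obtain rfl := Fin.ext h2
    exact ⟨_, .zero, holds_keep.2 h1⟩
  · rcases step (a := v .ctr) (c := v' .ctr) (b := ρ) (e := ρ') (by simp at h; omega) with h1 | h1
    · exact ⟨_, .neg h1.2, holds_keep.2 h1.1.symm⟩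
    · exact ⟨_, .borrow h1.2.2 h1.2.1, holds_dec.2 h1.1.symm⟩
  · rcases step (a := v' .ctr) (c := v .ctr) (b := ρ') (e := ρ) (by simp at h; omega) with h1 | h1
    · exact ⟨_, .pos h1.2, holds_keep.2 h1.1⟩
    · exact ⟨_, .carry h1.2.1 h1.2.2, holds_inc.2 h1.1⟩

/-- The states of the program. In the first group the description is parsed. In the second group the
one-counter automaton is in state `q` and its counter has remainder `ρ` modulo `K`; in `find` and
`skip` a transition is searched for, in `read` its label is read, and in `move` its target. -/
inductive ProgramState (Q : Type) (K : ℕ)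
  | size
  | start
  | accept (b : Bool)
  | source
  | label
  | target
  | home (q : Q) (ρ : Fin K)
  | find (q : Q) (ρ : Fin K)
  | skip (q : Q) (ρ : Fin K)
  | read (q : Q) (ρ : Fin K)
  | move (q : Q) (ρ : Fin K)
  | done

instance {Q : Type} [Finite Q] {K : ℕ} : Finite (ProgramState Q K) := by
  let f : ProgramState Q K → Fin 12 × Bool × Option (Q × Fin K)
    | .size => (0, false, none)
    | .start => (1, false, none)
    | .accept b => (2, b, none)
    | .source => (3, false, none)
    | .label => (4, false, none)
    | .target => (5, false, none)
    | .home q ρ => (6, false, some (q, ρ))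
    | .find q ρ => (7, false, some (q, ρ))
    | .skip q ρ => (8, false, some (q, ρ))
    | .read q ρ => (9, false, some (q, ρ))
    | .move q ρ => (10, false, some (q, ρ))
    | .done => (11, false, none)
  refine Finite.of_injective f ?_
  intro x y h
  cases x <;> cases y <;> simp_all [f]

variable {α : Type u} {Q : Type} {K : ℕ}

/-- The rules of the program, with the tests and the changes of the registers. -/
inductive Rule (M : OneCounterAutomaton α Q) : ProgramState Q K → InputSymbol (CodeSymbol α) →
    ProgramState Q K → HeadMove → List (Constraint Reg) → (Reg → Update) → Prop
  | enterTape : Rule M .size .leftEnd .size .right [] (updates .inc .keep .keep .keep .keep .keep)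
  | sizeTick : Rule M .size (.letter .tick) .size .right []
      (updates .inc .inc .keep .keep .keep .keep)
  | sizeComma : Rule M .size (.letter .comma) .start .right []
      (updates .inc .keep .keep .keep .keep .keep)
  | startTick : Rule M .start (.letter .tick) .start .right []
      (updates .inc .keep .keep .keep .inc .keep)
  | startComma : Rule M .start (.letter .comma) (.accept false) .right [isLt .count .size]
      (updates .inc .keep (.copy .count) .keep .zero .keep)
  | acceptTick {b : Bool} : Rule M (.accept b) (.letter .tick) (.accept b) .right []
      (updates .inc .keep .keep .keep .inc .keep)
  | acceptComma {b : Bool} : Rule M (.accept b) (.letter .comma) (.accept b) .right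
      [isLt .count .size] (updates .inc .keep .keep .keep .zero .keep)
  -- The accepting state in which the run is to end is guessed here; the flag records that a guess
  -- has been made, and the semicolon is passed only then.
  | acceptGoal {b : Bool} : Rule M (.accept b) (.letter .comma) (.accept true) .right
      [isLt .count .size] (updates .inc .keep .keep (.copy .count) .zero .keep)
  | semicolon : Rule M (.accept true) (.letter .semicolon) .source .right [isZero .count]
      (updates .inc .keep .keep .keep .keep .keep)
  | sourceTick : Rule M .source (.letter .tick) .source .right []
      (updates .inc .keep .keep .keep .inc .keep)
  | sourceComma : Rule M .source (.letter .comma) .label .right [isLt .count .size]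
      (updates .inc .keep .keep .keep .zero .keep)
  | label {a : Option α} : Rule M .label (.letter (.label a)) .target .right []
      (updates .inc .keep .keep .keep .keep .keep)
  | targetTick : Rule M .target (.letter .tick) .target .right []
      (updates .inc .keep .keep .keep .inc .keep)
  | targetComma : Rule M .target (.letter .comma) .source .right [isLt .count .size]
      (updates .inc .keep .keep .keep .zero .keep)
  -- An empty `count` ensures that the input does not end with ticks that no comma closes.
  | finish {ρ : Fin K} (h : ρ.val = 0) : Rule M .source .rightEnd (.home M.start ρ) .stay
      [isZero .count] (updates .keep .keep .keep .keep .keep .keep)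
  | rewind {q : Q} {ρ : Fin K} {s : InputSymbol (CodeSymbol α)} (h : s ≠ .letter .semicolon) :
      Rule M (.home q ρ) s (.home q ρ) .left [] (updates .keep .keep .keep .keep .keep .keep)
  | silent {q q' : Q} {ρ ρ' : Fin K} {s : InputSymbol (CodeSymbol α)} {z : Bool} {d : SignType}
      {ts : List (Constraint Reg)} {u : Update} (h : (q', d) ∈ M.step q none z)
      (hz : ZeroTest z ρ ts) (hd : CounterUpdate d ρ ρ' u) : Rule M (.home q ρ) s (.home q' ρ')
      .stay ts (updates .keep .keep .keep .keep .keep u)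
  | enter {q : Q} {ρ : Fin K} : Rule M (.home q ρ) (.letter .semicolon) (.find q ρ) .right []
      (updates .keep .keep .keep .keep .keep .keep)
  | findTick {q : Q} {ρ : Fin K} : Rule M (.find q ρ) (.letter .tick) (.find q ρ) .right []
      (updates .keep .keep .keep .keep .inc .keep)
  -- Any transition may be passed over, also a suitable one, so no test for inequality is needed.
  | findOther {q : Q} {ρ : Fin K} : Rule M (.find q ρ) (.letter .comma) (.skip q ρ) .right []
      (updates .keep .keep .keep .keep .zero .keep)
  | found {q : Q} {ρ : Fin K} : Rule M (.find q ρ) (.letter .comma) (.read q ρ) .right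
      [isEq .count .cur] (updates .keep .keep .keep .keep .zero .keep)
  | skipTick {q : Q} {ρ : Fin K} : Rule M (.skip q ρ) (.letter .tick) (.skip q ρ) .right []
      (updates .keep .keep .keep .keep .keep .keep)
  | skipLabel {q : Q} {ρ : Fin K} {a : Option α} : Rule M (.skip q ρ) (.letter (.label a))
      (.skip q ρ) .right [] (updates .keep .keep .keep .keep .keep .keep)
  | skipComma {q : Q} {ρ : Fin K} : Rule M (.skip q ρ) (.letter .comma) (.find q ρ) .right []
      (updates .keep .keep .keep .keep .keep .keep)
  | readEps {q : Q} {ρ : Fin K} : Rule M (.read q ρ) (.letter (.label none)) (.move q ρ) .right []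
      (updates .keep .keep .keep .keep .keep .keep)
  | readLetter {q q' : Q} {ρ ρ' : Fin K} {a : α} {z : Bool} {d : SignType}
      {ts : List (Constraint Reg)} {u : Update} (h : (q', d) ∈ M.step q (some a) z)
      (hz : ZeroTest z ρ ts) (hd : CounterUpdate d ρ ρ' u) :
      Rule M (.read q ρ) (.letter (.label (some a))) (.move q' ρ') .right ts
      (updates .keep .keep .keep .keep .keep u)
  | moveTick {q : Q} {ρ : Fin K} : Rule M (.move q ρ) (.letter .tick) (.move q ρ) .right []
      (updates .keep .keep .keep .keep .inc .keep)
  | moveComma {q : Q} {ρ : Fin K} : Rule M (.move q ρ) (.letter .comma) (.home q ρ) .right []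
      (updates .keep .keep (.copy .count) .keep .zero .keep)
  | halt {q : Q} {ρ : Fin K} {s : InputSymbol (CodeSymbol α)} (h : q ∈ M.accept) :
      Rule M (.home q ρ) s .done .stay [isEq .cur .goal]
      (updates .keep .keep .keep .keep .keep .keep)

/-- The register machine for the regular realizability problem of the filter given by `M`. -/
def program (M : OneCounterAutomaton α Q) (K : ℕ) :
    RegMachine (CodeSymbol α) Reg (ProgramState Q K) where
  start := .size
  accept := {.done}
  rules s a := {e | ∃ ts f, Rule M s a e.1 e.2.1 ts f ∧
    e.2.2 = {k | k ∈ ts ∨ ∃ i, k = (f i).constraint i}}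

theorem program_step_iff {M : OneCounterAutomaton α Q} {w : List (CodeSymbol α)}
    {c c' : ProgramState Q K × ℕ × (Reg → ℕ)} :
    (program M K).Step w c c' ↔ ∃ m ts f, Rule M c.1 (readInput w c.2.1) c'.1 m ts f ∧
      c'.2.1 = min (m.apply c.2.1) (w.length + 1) ∧ (∀ t ∈ ts, t.holds c.2.2 c'.2.2) ∧
      ∀ i, (f i).holds i c.2.2 c'.2.2 := by
  constructor
  · rintro ⟨m, _, ⟨ts, f, h, rfl⟩, hx, hk⟩
    exact ⟨m, ts, f, h, hx, fun t ht => hk t (.inl ht), fun i => hk _ (.inr ⟨i, rfl⟩)⟩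
  · rintro ⟨m, ts, f, h, hx, h1, h2⟩
    refine ⟨m, _, ⟨ts, f, h, rfl⟩, hx, ?_⟩
    rintro k (hk | ⟨i, rfl⟩)
    · exact h1 k hk
    · exact h2 i

theorem pos_le_of_program_step {M : OneCounterAutomaton α Q} {w : List (CodeSymbol α)}
    {c c' : ProgramState Q K × ℕ × (Reg → ℕ)} (h : (program M K).Step w c c') :
    c.2.2 .pos ≤ c'.2.2 .pos := by
  obtain ⟨m, ts, f, h, -, -, hf⟩ := program_step_iff.1 h
  have := hf .pos
  revert this
  generalize c.1 = s at h
  generalize c'.1 = s' at h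
  generalize readInput w c.2.1 = a at h
  cases h <;> simp only [updates, holds_inc, holds_keep] <;> omega

/-! ### Soundness -/

/-- The input head stands on cell `x` and sees the first letter of the suffix `rest` of `w`. -/
def At {Γ : Type*} (w pre rest : List Γ) (x : ℕ) : Prop :=
  w = pre ++ rest ∧ x = pre.length + 1

namespace At

variable {Γ : Type u} {w pre rest : List Γ} {x : ℕ}

theorem le (h : At w pre rest x) : x ≤ w.length + 1 := by
  obtain ⟨rfl, rfl⟩ := h
  simp

theorem letter (h : At w pre rest x) {a : Γ} (ha : readInput w x = .letter a) :
    ∃ rest', rest = a :: rest' ∧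
      At w (pre ++ [a]) rest' (min (HeadMove.right.apply x) (w.length + 1)) := by
  obtain ⟨rfl, rfl⟩ := h
  rcases rest with _ | ⟨b, rest⟩
  · simp [readInput] at ha
  · obtain rfl : b = a := by simpa [readInput] using ha
    exact ⟨rest, rfl, by simp, by simp [HeadMove.apply]⟩

theorem rightEnd (h : At w pre rest x) (ha : readInput w x = .rightEnd) : rest = [] := by
  obtain ⟨rfl, rfl⟩ := h
  rcases rest with _ | ⟨b, rest⟩
  · rfl
  · simp [readInput] at ha

theorem read_cons {a : Γ} (h : At w pre (a :: rest) x) : readInput w x = .letter a := by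
  obtain ⟨rfl, rfl⟩ := h
  simp [readInput]

theorem read_nil (h : At w pre [] x) : readInput w x = .rightEnd := by
  obtain ⟨rfl, rfl⟩ := h
  simp [readInput]

end At

theorem exists_at_of_readInput {Γ : Type u} {w : List Γ} {x : ℕ} {a : Γ}
    (h : readInput w x = .letter a) : ∃ pre rest, At w pre (a :: rest) x := by
  rcases x with _ | x
  · simp [readInput] at h
  · simp only [readInput] at h
    split at h
    · rename_i b hb
      obtain rfl : b = a := by simpa using h
      obtain ⟨hx, rfl⟩ := List.getElem?_eq_some_iff.1 hb
      exact ⟨w.take x, w.drop (x + 1), by simp, by simp [hx.le]⟩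
    · simp at h

theorem unaryCode_eq (k : ℕ) :
    (unaryCode k : List (CodeSymbol α)) = List.replicate k .tick ++ [.comma] := rfl

theorem semicolon_notMem_unaryCode (k : ℕ) :
    (CodeSymbol.semicolon : CodeSymbol α) ∉ unaryCode k := by
  simp [unaryCode]

theorem Description.semicolon_notMem_head (D : Description α) : CodeSymbol.semicolon ∉ D.head := by
  simp [Description.head, stateListCode, semicolon_notMem_unaryCode]

/-- The semicolon of a description is thus unique. It serves as the landmark from which every search
for a transition starts. -/
theorem semicolon_notMem_transitionListCode (Δ : List (ℕ × Option α × ℕ)) :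
    CodeSymbol.semicolon ∉ transitionListCode Δ := by
  simp [transitionListCode, semicolon_notMem_unaryCode]

/-- Unary blocks delimit themselves: the first comma determines the number and the remaining word.
-/
theorem unaryCode_append_eq {i j : ℕ} {r s : List (CodeSymbol α)}
    (h : unaryCode i ++ r = List.replicate j .tick ++ .comma :: s) : i = j ∧ r = s := by
  induction i generalizing j with
  | zero =>
    rcases j with _ | j
    · simpa [unaryCode] using h
    · simp [unaryCode, List.replicate_succ] at h
  | succ i ih =>
    rcases j with _ | j
    · simp [unaryCode, List.replicate_succ] at h
    · have := ih (j := j) (by simpa [unaryCode, List.replicate_succ] using h)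
      exact ⟨congrArg (· + 1) this.1, this.2⟩

/-- While the description is parsed, `pre` has been scanned and the counter is empty. -/
def Scanned (w : List (CodeSymbol α)) (x : ℕ) (v : Reg → ℕ) (pre : List (CodeSymbol α)) : Prop :=
  (∃ rest, At w pre rest x) ∧ v .pos = x ∧ v .ctr = 0

theorem Scanned.letter {w pre : List (CodeSymbol α)} {x : ℕ} {v v' : Reg → ℕ} {a : CodeSymbol α}
    (h : Scanned w x v pre) (ha : readInput w x = .letter a) (hp : v' .pos = v .pos + 1)
    (hc : v' .ctr = v .ctr) :
    Scanned w (min (HeadMove.right.apply x) (w.length + 1)) v' (pre ++ [a]) := by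
  obtain ⟨⟨rest, hr⟩, h1, h2⟩ := h
  obtain ⟨rest', rfl, h'⟩ := hr.letter ha
  refine ⟨⟨rest', h'⟩, ?_, by rw [hc, h2]⟩
  rw [hp, h1, h'.2, hr.2, List.length_append]
  rfl

/-- The scanned part of a description up to the list of accepting states. -/
def headCode (n q : ℕ) (F : List ℕ) : List (CodeSymbol α) :=
  unaryCode n ++ unaryCode q ++ stateListCode F

/-- The lists that have been parsed contain only states of the automaton. -/
def Valid (v : Reg → ℕ) (F : List ℕ) (Δ : List (ℕ × Option α × ℕ)) : Prop :=
  v .cur < v .size ∧ (∀ q ∈ F, q < v .size) ∧ v .goal ∈ F ∧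
    ∀ t ∈ Δ, t.1 < v .size ∧ t.2.2 < v .size

/-- The content of the registers while the product is simulated; `p` is the state of the finite
automaton. -/
def Running (M : OneCounterAutomaton α Q) (w : List (CodeSymbol α)) (D : Description α) (p : Fin D.n)
    (q : Q) (ρ : Fin K) (v : Reg → ℕ) : Prop :=
  w = D.code ∧ v .goal ∈ D.natAccept ∧ v .pos ≤ w.length + 1 ∧ D.Reach M p q (K * v .ctr + ρ)

/-- The invariant of the program. -/
def ProgramInv (M : OneCounterAutomaton α Q) (w : List (CodeSymbol α)) (x : ℕ) (v : Reg → ℕ) :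
    ProgramState Q K → Prop
  | .size => (x = 0 ∧ ∀ i, v i = 0) ∨
      Scanned w x v (List.replicate (v .size) .tick) ∧ v .count = 0
  | .start => Scanned w x v (unaryCode (v .size) ++ List.replicate (v .count) .tick)
  | .accept b => ∃ F, Scanned w x v
      (headCode (v .size) (v .cur) F ++ List.replicate (v .count) .tick) ∧
      v .cur < v .size ∧ (∀ q ∈ F, q < v .size) ∧ (b = true → v .goal ∈ F)
  | .source => ∃ F Δ, Scanned w x v (headCode (v .size) (v .cur) F ++ [.semicolon] ++
      transitionListCode Δ ++ List.replicate (v .count) .tick) ∧ Valid v F Δ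
  | .label => ∃ F Δ p, Scanned w x v (headCode (v .size) (v .cur) F ++ [.semicolon] ++
      transitionListCode Δ ++ unaryCode p) ∧ Valid v F Δ ∧ p < v .size ∧ v .count = 0
  | .target => ∃ F Δ p a, Scanned w x v (headCode (v .size) (v .cur) F ++ [.semicolon] ++
      transitionListCode Δ ++ unaryCode p ++ [.label a] ++ List.replicate (v .count) .tick) ∧
      Valid v F Δ ∧ p < v .size
  | .home q ρ => ∃ D p, Running M w D p q ρ v ∧ v .cur = p ∧ v .count = 0
  -- `Δ` consists of the transitions not yet passed; of its code, the ticks counted so far have been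
  -- scanned.
  | .find q ρ => ∃ D p, Running M w D p q ρ v ∧ v .cur = p ∧ ∃ Δ pre rest,
      Δ ⊆ D.natTransitions ∧ At w pre rest x ∧
        transitionListCode Δ = List.replicate (v .count) .tick ++ rest
  | .skip q ρ => ∃ D p, Running M w D p q ρ v ∧ v .cur = p ∧ v .count = 0 ∧ ∃ Δ pre rest,
      Δ ⊆ D.natTransitions ∧ At w pre rest x ∧
        ((∃ a k, rest = .label a :: (unaryCode k ++ transitionListCode Δ)) ∨
          ∃ k, rest = unaryCode k ++ transitionListCode Δ)
  | .read q ρ => ∃ D p, Running M w D p q ρ v ∧ v .cur = p ∧ v .count = 0 ∧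
      ∃ (a : Option α) (p' : Fin D.n) (pre z : List (CodeSymbol α)), (p, a, p') ∈ D.transitions ∧
        At w pre (.label a :: (unaryCode p' ++ z)) x
  -- Here `p` is already the target of the transition, whereas `cur` is replaced only after the
  -- target has been scanned.
  | .move q ρ => ∃ D p, Running M w D p q ρ v ∧ ∃ pre rest z, At w pre rest x ∧
      unaryCode p ++ z = List.replicate (v .count) .tick ++ rest
  | .done => w ∈ NRR M.accepts ∧ v .pos ≤ w.length + 1

theorem ProgramInv.pos_le {M : OneCounterAutomaton α Q} {w : List (CodeSymbol α)} {x : ℕ} {v : Reg → ℕ}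
    {s : ProgramState Q K} (h : ProgramInv M w x v s) : v .pos ≤ w.length + 1 := by
  have key : ∀ {pre}, Scanned w x v pre → v .pos ≤ w.length + 1 := by
    rintro pre ⟨⟨rest, h⟩, hx, -⟩
    exact hx ▸ h.le
  cases s with
  | size =>
    rcases h with h | h
    · simp [h.2]
    · exact key h.1
  | start => exact key h
  | accept => obtain ⟨_, h, _⟩ := h; exact key h
  | source => obtain ⟨_, _, h, _⟩ := h; exact key h
  | label => obtain ⟨_, _, _, h, _⟩ := h; exact key h
  | target => obtain ⟨_, _, _, _, h, _⟩ := h; exact key h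
  | home => obtain ⟨_, _, ⟨_, _, h, _⟩, _⟩ := h; exact h
  | find => obtain ⟨_, _, ⟨_, _, h, _⟩, _⟩ := h; exact h
  | skip => obtain ⟨_, _, ⟨_, _, h, _⟩, _⟩ := h; exact h
  | read => obtain ⟨_, _, ⟨_, _, h, _⟩, _⟩ := h; exact h
  | move => obtain ⟨_, _, ⟨_, _, h, _⟩, _⟩ := h; exact h
  | done => exact h.2

theorem stateListCode_append_singleton (F : List ℕ) (q : ℕ) :
    (stateListCode (F ++ [q]) : List (CodeSymbol α)) = stateListCode F ++ unaryCode q := by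
  simp [stateListCode]

theorem transitionListCode_append_singleton (Δ : List (ℕ × Option α × ℕ)) (t : ℕ × Option α × ℕ) :
    transitionListCode (Δ ++ [t]) =
      transitionListCode Δ ++ (unaryCode t.1 ++ [.label t.2.1] ++ unaryCode t.2.2) := by
  simp [transitionListCode]

theorem transitionListCode_cons (t : ℕ × Option α × ℕ) (Δ : List (ℕ × Option α × ℕ)) :
    transitionListCode (t :: Δ) =
      unaryCode t.1 ++ .label t.2.1 :: (unaryCode t.2.2 ++ transitionListCode Δ) := by
  simp [transitionListCode]

/-- A completely parsed word is a description. -/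
theorem exists_description {w : List (CodeSymbol α)} {v : Reg → ℕ} {F : List ℕ}
    {Δ : List (ℕ × Option α × ℕ)} (h : Valid v F Δ)
    (hw : w = headCode (v .size) (v .cur) F ++ [.semicolon] ++ transitionListCode Δ) :
    ∃ D : Description α, w = D.code ∧ v .goal ∈ D.natAccept ∧ v .cur = D.start := by
  obtain ⟨h1, h2, h3, h4⟩ := h
  obtain ⟨F', rfl⟩ : F ∈ Set.range (List.map (Fin.val : Fin (v .size) → ℕ)) := by
    rw [Set.range_list_map]
    exact fun q hq => ⟨⟨q, h2 q hq⟩, rfl⟩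
  obtain ⟨Δ', rfl⟩ : Δ ∈ Set.range (List.map fun t : Fin (v .size) × Option α × Fin (v .size) =>
      ((t.1 : ℕ), t.2.1, (t.2.2 : ℕ))) := by
    rw [Set.range_list_map]
    exact fun t ht => ⟨(⟨t.1, (h4 t ht).1⟩, t.2.1, ⟨t.2.2, (h4 t ht).2⟩), rfl⟩
  refine ⟨⟨v .size, ⟨v .cur, h1⟩, F', Δ'⟩, ?_, h3, rfl⟩
  simp [hw, Description.code, Description.head, headCode, Description.natAccept,
    Description.natTransitions]

theorem Description.mem_natTransitions {D : Description α} {p : Fin D.n} {a : Option α} {k : ℕ}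
    (h : ((p : ℕ), a, k) ∈ D.natTransitions) :
    ∃ p' : Fin D.n, (p' : ℕ) = k ∧ (p, a, p') ∈ D.transitions := by
  obtain ⟨⟨r, b, r'⟩, ht, h⟩ := List.mem_map.1 h
  simp only [Prod.mk.injEq] at h
  obtain ⟨h1, rfl, rfl⟩ := h
  obtain rfl := Fin.ext h1
  exact ⟨r', rfl, ht⟩

theorem Running.congr {M : OneCounterAutomaton α Q} {w : List (CodeSymbol α)} {D : Description α}
    {p : Fin D.n} {q : Q} {ρ : Fin K} {v v' : Reg → ℕ} (h : Running M w D p q ρ v)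
    (hg : v' .goal = v .goal) (hx : v' .pos = v .pos) (hc : v' .ctr = v .ctr) :
    Running M w D p q ρ v' := by
  unfold Running at *
  rwa [hg, hx, hc]

theorem Running.step {M : OneCounterAutomaton α Q} {w : List (CodeSymbol α)} {D : Description α}
    {p p' : Fin D.n} {q q' : Q} {ρ ρ' : Fin K} {v v' : Reg → ℕ} {z : Bool} {d : SignType}
    {ts : List (Constraint Reg)} {u : Update} (h : Running M w D p q ρ v)
    (hg : v' .goal = v .goal) (hx : v' .pos = v .pos)
    (hs : ProductStep D.toNFA M (p, q) z (p', q') d) (hz : ZeroTest z ρ ts)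
    (hd : CounterUpdate d ρ ρ' u) (hts : ∀ t ∈ ts, t.holds v v') (hu : u.holds .ctr v v') :
    Running M w D p' q' ρ' v' := by
  obtain ⟨h1, h2, h3, h4⟩ := h
  refine ⟨h1, hg ▸ h2, hx ▸ h3, h4.tail ⟨d, ?_, hd.counter_eq hu⟩⟩
  rwa [← hz.eq_decide hts]

/-- The invariant holds after every step. -/
theorem ProgramInv.step {M : OneCounterAutomaton α Q} {w : List (CodeSymbol α)} {x : ℕ} {v v' : Reg → ℕ}
    {s s' : ProgramState Q K} {a : InputSymbol (CodeSymbol α)} {m : HeadMove}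
    {ts : List (Constraint Reg)} {f : Reg → Update} (h : ProgramInv M w x v s) (hr : Rule M s a s' m ts f)
    (ha : readInput w x = a) (hts : ∀ t ∈ ts, t.holds v v') (hf : ∀ i, (f i).holds i v v') :
    ProgramInv M w (min (m.apply x) (w.length + 1)) v' s' := by
  cases hr
  case silent hs hd hz =>
    obtain ⟨hx, hn, hp, hg, hc, hu⟩ := forall_updates_holds.1 hf
    rw [holds_keep] at hx hn hp hg hc
    obtain ⟨D, p, h, h1, h2⟩ := h
    exact ⟨D, p, h.step hg hx (.silent hs) hz hd hts hu, hp ▸ h1, hc ▸ h2⟩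
  case readLetter hs hd hz =>
    obtain ⟨hx, hn, hp, hg, hc, hu⟩ := forall_updates_holds.1 hf
    rw [holds_keep] at hx hn hp hg hc
    obtain ⟨D, p, h, h1, h2, b, p', pre, z, h3, h4⟩ := h
    obtain ⟨rest, hrest, h5⟩ := h4.letter ha
    obtain ⟨hb, rfl⟩ := List.cons.inj hrest
    obtain rfl : b = some _ := by simpa using hb
    exact ⟨D, p', h.step hg hx (.read h3 hs) hz hd hts hu, _, _, z, h5, by simp [hc, h2]⟩
  all_goals
    obtain ⟨hx, hn, hp, hg, hc, hr⟩ := forall_updates_holds.1 hf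
    simp only [holds_keep, holds_inc, holds_zero, holds_copy] at hx hn hp hg hc hr
    try simp only [List.forall_mem_singleton, holds_isZero, holds_isLt, holds_isEq] at hts
  case enterTape =>
    rcases h with ⟨rfl, h⟩ | ⟨⟨⟨rest, h⟩, -⟩, -⟩
    · refine .inr ⟨⟨⟨w, by simp [hn, h], ?_⟩, ?_, by simp [hr, h]⟩, by simp [hc, h]⟩
      · simp [HeadMove.apply, hn, h]
      · simp [HeadMove.apply, hx, h]
    · rcases rest with _ | ⟨b, rest⟩
      · simp [h.read_nil] at ha
      · simp [h.read_cons] at ha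
  case sizeTick =>
    rcases h with ⟨rfl, h⟩ | ⟨h, h'⟩
    · simp [readInput] at ha
    · refine .inr ⟨?_, by rw [hc, h']⟩
      rw [hn, List.replicate_succ']
      exact h.letter ha hx hr
  case sizeComma =>
    rcases h with ⟨rfl, h⟩ | ⟨h, h'⟩
    · simp [readInput] at ha
    · have := h.letter ha hx hr
      simpa [ProgramInv, hn, hc, h', unaryCode_eq] using this
  case startTick =>
    have := h.letter ha hx hr
    simpa [ProgramInv, hn, hc, List.replicate_succ'] using this
  case startComma =>
    refine ⟨[], ?_, by simpa [hp, hn] using hts, by simp, by simp⟩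
    have := h.letter ha hx hr
    simpa [hn, hp, hc, headCode, stateListCode, unaryCode_eq] using this
  case acceptTick =>
    obtain ⟨F, h, h1⟩ := h
    refine ⟨F, ?_, by rwa [hp, hn, hg]⟩
    have := h.letter ha hx hr
    simpa [hn, hp, hc, List.replicate_succ'] using this
  case acceptComma =>
    obtain ⟨F, h, h1, h2, h3⟩ := h
    refine ⟨F ++ [v .count], ?_, by rwa [hp, hn], ?_, ?_⟩
    · have := h.letter ha hx hr
      simpa [hn, hp, hc, headCode, stateListCode_append_singleton, unaryCode_eq] using this
    · rw [hn]
      simpa [or_imp, forall_and] using ⟨h2, hts⟩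
    · rw [hg]
      exact fun hb => by simp [h3 hb]
  case acceptGoal =>
    obtain ⟨F, h, h1, h2, h3⟩ := h
    refine ⟨F ++ [v .count], ?_, by rwa [hp, hn], ?_, ?_⟩
    · have := h.letter ha hx hr
      simpa [hn, hp, hc, headCode, stateListCode_append_singleton, unaryCode_eq] using this
    · rw [hn]
      simpa [or_imp, forall_and] using ⟨h2, hts⟩
    · simp [hg]
  case semicolon =>
    obtain ⟨F, h, h1, h2, h3⟩ := h
    refine ⟨F, [], ?_, by rwa [hp, hn], by rwa [hn], by rw [hg]; exact h3 rfl, by simp⟩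
    have := h.letter ha hx hr
    simpa [hn, hp, hc, hts, transitionListCode] using this
  case sourceTick =>
    obtain ⟨F, Δ, h, h1⟩ := h
    refine ⟨F, Δ, ?_, by unfold Valid at *; rwa [hp, hn, hg]⟩
    have := h.letter ha hx hr
    simpa [hn, hp, hc, List.replicate_succ'] using this
  case sourceComma =>
    obtain ⟨F, Δ, h, h1⟩ := h
    refine ⟨F, Δ, v .count, ?_, by unfold Valid at *; rwa [hp, hn, hg], by rwa [hn], hc⟩
    have := h.letter ha hx hr
    simpa [hn, hp, unaryCode_eq] using this
  case label b =>
    obtain ⟨F, Δ, p, h, h1, h2, h3⟩ := h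
    refine ⟨F, Δ, p, b, ?_, by unfold Valid at *; rwa [hp, hn, hg], by rwa [hn]⟩
    have := h.letter ha hx hr
    simpa [hn, hp, hc, h3] using this
  case targetTick =>
    obtain ⟨F, Δ, p, b, h, h1, h2⟩ := h
    refine ⟨F, Δ, p, b, ?_, by unfold Valid at *; rwa [hp, hn, hg], by rwa [hn]⟩
    have := h.letter ha hx hr
    simpa [hn, hp, hc, List.replicate_succ'] using this
  case targetComma =>
    obtain ⟨F, Δ, p, b, h, ⟨h1, h2, h3, h4⟩, h5⟩ := h
    refine ⟨F, Δ ++ [(p, b, v .count)], ?_, by rwa [hp, hn], by rwa [hn], by rwa [hg], ?_⟩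
    · have := h.letter ha hx hr
      simpa [hn, hp, hc, transitionListCode_append_singleton, unaryCode_eq] using this
    · rw [hn]
      intro t ht
      rcases List.mem_append.1 ht with ht | ht
      · exact h4 t ht
      · obtain rfl := List.mem_singleton.1 ht
        exact ⟨h5, hts⟩
  case finish ρ hρ =>
    obtain ⟨F, Δ, h, h1⟩ := h
    have hb : v .pos ≤ w.length + 1 := h.2.1 ▸ h.1.choose_spec.le
    obtain ⟨⟨rest, h⟩, -, h0⟩ := h
    obtain rfl := h.rightEnd ha
    obtain ⟨D, rfl, h2, h3⟩ := exists_description h1 (by simpa [hts] using h.1)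
    refine ⟨D, D.start, ⟨rfl, hg ▸ h2, hx ▸ hb, ?_⟩, hp ▸ h3, hc.trans hts⟩
    rw [hr, h0, hρ]
    exact .refl
  case rewind =>
    obtain ⟨D, p, h, h1, h2⟩ := h
    exact ⟨D, p, h.congr hg hx hr, hp ▸ h1, hc ▸ h2⟩
  case enter =>
    obtain ⟨D, p, h, h1, h2⟩ := h
    obtain ⟨pre, rest, h3⟩ := exists_at_of_readInput ha
    obtain ⟨rest', hrest, h4⟩ := h3.letter ha
    obtain ⟨-, rfl⟩ := List.cons.inj hrest
    refine ⟨D, p, h.congr hg hx hr, hp ▸ h1, D.natTransitions, _, rest, fun _ => id, h4, ?_⟩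
    -- As the semicolon is unique, the head has just entered the list of transitions.
    have h5 : D.head ++ .semicolon :: transitionListCode D.natTransitions =
      pre ++ .semicolon :: rest := h.1.symm.trans h3.1
    have h6 := (List.append_cons_inj_of_notMem D.semicolon_notMem_head
      (semicolon_notMem_transitionListCode _)).1 h5
    simp [hc, h2, h6]
  case findTick =>
    obtain ⟨D, p, h, h1, Δ, pre, rest, h2, h3, h4⟩ := h
    obtain ⟨rest, rfl, h5⟩ := h3.letter ha
    exact ⟨D, p, h.congr hg hx hr, hp ▸ h1, Δ, _, rest, h2, h5, by
      simp [h4, hc, List.replicate_succ']⟩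
  case findOther =>
    obtain ⟨D, p, h, h1, Δ, pre, rest, h2, h3, h4⟩ := h
    obtain ⟨rest, rfl, h5⟩ := h3.letter ha
    rcases Δ with _ | ⟨t, Δ⟩
    · simp [transitionListCode] at h4
    · rw [transitionListCode_cons] at h4
      obtain ⟨-, rfl⟩ := unaryCode_append_eq h4
      exact ⟨D, p, h.congr hg hx hr, hp ▸ h1, hc, Δ, _, _, fun e he => h2 (by simp [he]), h5,
        .inl ⟨_, _, rfl⟩⟩
  case found =>
    obtain ⟨D, p, h, h1, Δ, pre, rest, h2, h3, h4⟩ := h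
    obtain ⟨rest, rfl, h5⟩ := h3.letter ha
    rcases Δ with _ | ⟨⟨r, b, r'⟩, Δ⟩
    · simp [transitionListCode] at h4
    · rw [transitionListCode_cons] at h4
      obtain ⟨h6, rfl⟩ := unaryCode_append_eq h4
      simp only at h6
      -- The source just scanned is `count`, which passed the test against `cur`; so the transition
      -- starts in `p`.
      rw [hts, h1] at h6
      subst h6
      obtain ⟨p', rfl, h7⟩ := Description.mem_natTransitions (h2 (List.mem_cons_self ..))
      exact ⟨D, p, h.congr hg hx hr, hp ▸ h1, hc, b, p', _, _, h7, h5⟩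
  case skipTick =>
    obtain ⟨D, p, h, h1, h2, Δ, pre, rest, h3, h4, h5⟩ := h
    obtain ⟨rest, rfl, h6⟩ := h4.letter ha
    refine ⟨D, p, h.congr hg hx hr, hp ▸ h1, hc ▸ h2, Δ, _, rest, h3, h6, .inr ?_⟩
    rcases h5 with ⟨_, _, h5⟩ | ⟨k, h5⟩
    · simp at h5
    · rcases k with _ | k
      · simp [unaryCode] at h5
      · exact ⟨k, by simpa [unaryCode, List.replicate_succ] using h5⟩
  case skipLabel =>
    obtain ⟨D, p, h, h1, h2, Δ, pre, rest, h3, h4, h5⟩ := h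
    obtain ⟨rest, rfl, h6⟩ := h4.letter ha
    refine ⟨D, p, h.congr hg hx hr, hp ▸ h1, hc ▸ h2, Δ, _, rest, h3, h6, .inr ?_⟩
    rcases h5 with ⟨_, k, h5⟩ | ⟨k, h5⟩
    · exact ⟨k, (List.cons.inj h5).2⟩
    · rcases k with _ | k <;> simp [unaryCode, List.replicate_succ] at h5
  case skipComma =>
    obtain ⟨D, p, h, h1, h2, Δ, pre, rest, h3, h4, h5⟩ := h
    obtain ⟨rest, rfl, h6⟩ := h4.letter ha
    refine ⟨D, p, h.congr hg hx hr, hp ▸ h1, Δ, _, rest, h3, h6, ?_⟩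
    rcases h5 with ⟨_, k, h5⟩ | ⟨k, h5⟩
    · simp at h5
    · rcases k with _ | k
      · simpa [unaryCode, hc, h2, eq_comm] using h5
      · simp [unaryCode, List.replicate_succ] at h5
  case readEps =>
    obtain ⟨D, p, h, h1, h2, b, p', pre, z, h3, h4⟩ := h
    obtain ⟨rest, hrest, h5⟩ := h4.letter ha
    obtain ⟨hb, rfl⟩ := List.cons.inj hrest
    obtain rfl : b = none := by simpa using hb
    obtain ⟨g1, g2, g3, g4⟩ := h
    refine ⟨D, p', ⟨g1, hg ▸ g2, hx ▸ g3, ?_⟩, _, _, z, h5, by simp [hc, h2]⟩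
    rw [hr]
    exact g4.tail ⟨0, .eps h3, by simp⟩
  case moveTick =>
    obtain ⟨D, p, h, pre, rest, z, h1, h2⟩ := h
    obtain ⟨rest, rfl, h3⟩ := h1.letter ha
    exact ⟨D, p, h.congr hg hx hr, _, rest, z, h3, by simp [h2, hc, List.replicate_succ']⟩
  case moveComma =>
    obtain ⟨D, p, h, pre, rest, z, h1, h2⟩ := h
    obtain ⟨rest, rfl, h3⟩ := h1.letter ha
    exact ⟨D, p, h.congr hg hx hr, hp.trans (unaryCode_append_eq h2).1.symm, hc⟩
  case halt hq =>
    obtain ⟨D, p, ⟨rfl, g2, g3, g4⟩, h1, h2⟩ := h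
    obtain ⟨p', hp', h3⟩ := List.mem_map.1 g2
    obtain rfl : p' = p := Fin.ext (by rw [h3, ← hts, h1])
    exact ⟨Description.mem_NRR_of_reach hp' hq g4, hx ▸ g3⟩

theorem inv_of_reachable {M : OneCounterAutomaton α Q} {w : List (CodeSymbol α)}
    {c : ProgramState Q K × ℕ × (Reg → ℕ)} (h : (program M K).Reachable w c) :
    ProgramInv M w c.2.1 c.2.2 c.1 := by
  induction h with
  | refl => exact .inl ⟨rfl, fun _ => rfl⟩
  | tail _ h ih =>
    obtain ⟨m, ts, f, hr, hx, hts, hf⟩ := program_step_iff.1 h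
    rw [hx]
    exact ih.step hr rfl hts hf

/-! ### Completeness -/

/-- The registers with the given contents. -/
def regs (x n p g c r : ℕ) : Reg → ℕ
  | .pos => x
  | .size => n
  | .cur => p
  | .goal => g
  | .count => c
  | .ctr => r

/-- Computations of the program in which all registers stay below `pos`. -/
def Computes (M : OneCounterAutomaton α Q) (w : List (CodeSymbol α)) :
    ProgramState Q K × ℕ × (Reg → ℕ) → ProgramState Q K × ℕ × (Reg → ℕ) → Prop :=
  ReflTransGen ((program M K).BoundedStep .pos w)

variable {M : OneCounterAutomaton α Q} {w : List (CodeSymbol α)}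

theorem Computes.refl (c : ProgramState Q K × ℕ × (Reg → ℕ)) : Computes M w c c :=
  ReflTransGen.refl

theorem Computes.trans {c₁ c₂ c₃ : ProgramState Q K × ℕ × (Reg → ℕ)} (h : Computes M w c₁ c₂)
    (h' : Computes M w c₂ c₃) : Computes M w c₁ c₃ :=
  ReflTransGen.trans h h'

theorem Computes.of_rule {s s' : ProgramState Q K} {a : InputSymbol (CodeSymbol α)} {m : HeadMove}
    {ts : List (Constraint Reg)} {f : Reg → Update} {x y y' n n' p p' g g' c c' r r' : ℕ}
    (hr : Rule M s a s' m ts f) (ha : readInput w x = a)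
    (hts : ∀ t ∈ ts, t.holds (regs y n p g c r) (regs y' n' p' g' c' r'))
    (hf : ∀ i, (f i).holds i (regs y n p g c r) (regs y' n' p' g' c' r'))
    (hle : n' ≤ y' ∧ p' ≤ y' ∧ g' ≤ y' ∧ c' ≤ y' ∧ r' ≤ y') (hy : y' ≤ y + 1) :
    Computes M w (s, x, regs y n p g c r)
      (s', min (m.apply x) (w.length + 1), regs y' n' p' g' c' r') :=
  .single ⟨program_step_iff.2 ⟨m, ts, f, by rwa [ha], rfl, hts, hf⟩,
    Reg.forall_iff.2 ⟨le_rfl, hle⟩, hy⟩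

theorem readInput_append (pre : List (CodeSymbol α)) (a : CodeSymbol α)
    (rest : List (CodeSymbol α)) :
    readInput (pre ++ a :: rest) (pre.length + 1) = .letter a :=
  At.read_cons ⟨rfl, rfl⟩

/-- A configuration of the first phase, after `pre` has been scanned. -/
def parseConfig (s : ProgramState Q K) (pre : List (CodeSymbol α)) (n p g c : ℕ) :
    ProgramState Q K × ℕ × (Reg → ℕ) :=
  (s, pre.length + 1, regs (pre.length + 1) n p g c 0)

theorem computes_parse_letter {s s' : ProgramState Q K} {a : CodeSymbol α}
    {ts : List (Constraint Reg)} {f : Reg → Update} {pre rest : List (CodeSymbol α)}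
    {n n' p p' g g' c c' : ℕ} (hr : Rule M s (.letter a) s' .right ts f)
    (hw : w = pre ++ a :: rest)
    (hts : ∀ t ∈ ts, t.holds (regs (pre.length + 1) n p g c 0)
      (regs (pre.length + 2) n' p' g' c' 0))
    (hf : ∀ i, (f i).holds i (regs (pre.length + 1) n p g c 0)
      (regs (pre.length + 2) n' p' g' c' 0))
    (hle : n' ≤ pre.length + 2 ∧ p' ≤ pre.length + 2 ∧ g' ≤ pre.length + 2 ∧ c' ≤ pre.length + 2) :
    Computes M w (parseConfig s pre n p g c) (parseConfig s' (pre ++ [a]) n' p' g' c') := by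
  have := Computes.of_rule (w := w) (x := pre.length + 1) hr (by rw [hw, readInput_append]) hts hf
    ⟨hle.1, hle.2.1, hle.2.2.1, hle.2.2.2, by omega⟩ le_rfl
  have h1 : min (HeadMove.right.apply (pre.length + 1)) (w.length + 1) = (pre ++ [a]).length + 1 := by
    simp [hw, HeadMove.apply]
  rw [h1] at this
  simpa [parseConfig] using this

theorem computes_parse_ticks {s : ProgramState Q K} {pre rest : List (CodeSymbol α)} {n p g c k : ℕ}
    (hs : Rule M s (.letter .tick) s .right [] (updates .inc .keep .keep .keep .inc .keep))
    (hw : w = pre ++ List.replicate k .tick ++ rest)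
    (hle : n ≤ pre.length + 1 ∧ p ≤ pre.length + 1 ∧ g ≤ pre.length + 1 ∧ c ≤ pre.length + 1) :
    Computes M w (parseConfig s pre n p g c)
      (parseConfig s (pre ++ List.replicate k .tick) n p g (c + k)) := by
  induction k generalizing rest with
  | zero => simpa using Computes.refl _
  | succ k ih =>
    rw [List.replicate_succ'] at hw
    refine (ih (rest := .tick :: rest) (by simp [hw])).trans ?_
    have := computes_parse_letter (M := M) (w := w) (n := n) (n' := n) (p := p) (p' := p) (g := g)
      (g' := g) (c := c + k) (c' := c + k + 1) hs
      (pre := pre ++ List.replicate k .tick) (rest := rest) (by simp [hw]) (by simp)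
      (forall_updates_holds.2 (by simp [holds_keep, holds_inc, regs]))
      (by simp only [List.length_append, List.length_replicate]; omega)
    simpa [List.replicate_succ', add_assoc] using this

/-- This covers all blocks that name a state: the initial state, accepting states, sources and
targets. They differ only in what is copied to `cur` and `goal`. -/
theorem computes_parse_block {s s' : ProgramState Q K} {pre rest : List (CodeSymbol α)}
    {n p p' g g' k : ℕ} {up ug : Update}
    (hs : Rule M s (.letter .tick) s .right [] (updates .inc .keep .keep .keep .inc .keep))
    (hs' : Rule M s (.letter .comma) s' .right [isLt .count .size]
      (updates .inc .keep up ug .zero .keep))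
    (hp : ∀ y y' c', up.holds .cur (regs y n p g k 0) (regs y' n p' g' c' 0))
    (hg : ∀ y y' c', ug.holds .goal (regs y n p g k 0) (regs y' n p' g' c' 0))
    (hw : w = pre ++ unaryCode k ++ rest) (hk : k < n)
    (hle : n ≤ pre.length + 1 ∧ p ≤ pre.length + 1 ∧ g ≤ pre.length + 1)
    (hle' : p' ≤ pre.length + 1 ∧ g' ≤ pre.length + 1) :
    Computes M w (parseConfig s pre n p g 0) (parseConfig s' (pre ++ unaryCode k) n p' g' 0) := by
  have h1 := computes_parse_ticks (M := M) (w := w) (n := n) (p := p) (g := g) (c := 0) (k := k) hs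
    (pre := pre) (rest := .comma :: rest) (by simp [hw, unaryCode_eq]) (by omega)
  have h2 := computes_parse_letter (M := M) (w := w) (c := k) (c' := 0) (n := n) (n' := n) (p := p)
    (g := g) hs' (pre := pre ++ List.replicate k .tick) (rest := rest)
    (by simp [hw, unaryCode_eq]) (by simpa using holds_isLt.2 hk)
    (forall_updates_holds.2 ⟨by simp [holds_inc, regs], by simp [holds_keep, regs], hp _ _ _,
      hg _ _ _, by simp [holds_zero, regs], by simp [holds_keep, regs]⟩)
    (by simp only [List.length_append, List.length_replicate]; omega)
  rw [zero_add] at h1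
  simpa [unaryCode_eq] using h1.trans h2

theorem computes_parse_size {n : ℕ} {rest : List (CodeSymbol α)}
    (hw : w = unaryCode n ++ rest) :
    Computes (K := K) M w (.size, 0, fun _ => 0)
      (parseConfig .start (unaryCode n : List (CodeSymbol α)) n 0 0 0) := by
  have h0 : (fun _ => 0 : Reg → ℕ) = regs 0 0 0 0 0 0 := funext fun i => by cases i <;> rfl
  have h1 : Computes (K := K) M w (.size, 0, fun _ => 0)
      (parseConfig .size ([] : List (CodeSymbol α)) 0 0 0 0) := by
    rw [h0]
    have := Computes.of_rule (M := M) (w := w) (K := K) (x := 0) (y := 0) (y' := 1) (n := 0)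
      (n' := 0) (p := 0) (p' := 0) (g := 0) (g' := 0) (c := 0) (c' := 0) (r := 0) (r' := 0) .enterTape rfl
      (by simp) (forall_updates_holds.2 (by simp [holds_keep, holds_inc, regs])) (by simp) le_rfl
    simpa [HeadMove.apply, parseConfig] using this
  have h2 : ∀ k rest, w = List.replicate k .tick ++ rest → Computes (K := K) M w
      (parseConfig .size ([] : List (CodeSymbol α)) 0 0 0 0)
      (parseConfig .size (List.replicate k (.tick : CodeSymbol α)) k 0 0 0) := by
    intro k
    induction k with
    | zero => exact fun _ _ => .refl _
    | succ k ih =>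
      intro rest hw
      rw [List.replicate_succ'] at hw ⊢
      refine (ih (.tick :: rest) (by simp [hw])).trans ?_
      exact computes_parse_letter (n := k) (n' := k + 1) (p := 0) (p' := 0) (g := 0) (g' := 0) (c := 0)
        (c' := 0) (rest := rest) .sizeTick (by simp [hw]) (by simp)
        (forall_updates_holds.2 (by simp [holds_keep, holds_inc, regs])) (by simp)
  refine (h1.trans (h2 n (.comma :: rest) (by simp [hw, unaryCode_eq]))).trans ?_
  exact computes_parse_letter (n := n) (n' := n) (p := 0) (p' := 0) (g := 0) (g' := 0) (c := 0)
    (c' := 0) (rest := rest) .sizeComma (by simp [hw, unaryCode_eq]) (by simp)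
    (forall_updates_holds.2 (by simp [holds_keep, holds_inc, regs])) (by simp)

/-- Used for the accepting states before and after the chosen one, which leave `goal` unchanged. -/
theorem computes_parse_accept {b : Bool} {F : List ℕ} {pre rest : List (CodeSymbol α)} {n p g : ℕ}
    (hw : w = pre ++ stateListCode F ++ rest) (hF : ∀ q ∈ F, q < n)
    (hle : n ≤ pre.length + 1 ∧ p ≤ pre.length + 1 ∧ g ≤ pre.length + 1) :
    Computes (K := K) M w (parseConfig (.accept b) pre n p g 0)
      (parseConfig (.accept b) (pre ++ stateListCode F) n p g 0) := by
  induction F generalizing pre with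
  | nil => simpa [stateListCode] using Computes.refl _
  | cons q F ih =>
    have hc : (stateListCode (q :: F) : List (CodeSymbol α)) = unaryCode q ++ stateListCode F := by
      simp [stateListCode]
    rw [hc] at hw ⊢
    have h1 := computes_parse_block (M := M) (w := w) (K := K) (p := p) (p' := p) (g := g) (g' := g)
      .acceptTick (.acceptComma (b := b)) (fun _ _ _ => rfl) (fun _ _ _ => rfl)
      (pre := pre) (k := q) (rest := stateListCode F ++ rest) (by simp [hw]) (hF q (by simp)) hle
      hle.2
    have h2 := ih (pre := pre ++ unaryCode q) (by simp [hw]) (fun r hr => hF r (by simp [hr]))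
      (by simp only [List.length_append]; omega)
    simpa using h1.trans h2

theorem computes_parse_transitions {Δ : List (ℕ × Option α × ℕ)} {pre rest : List (CodeSymbol α)}
    {n p g : ℕ} (hw : w = pre ++ transitionListCode Δ ++ rest)
    (hΔ : ∀ t ∈ Δ, t.1 < n ∧ t.2.2 < n)
    (hle : n ≤ pre.length + 1 ∧ p ≤ pre.length + 1 ∧ g ≤ pre.length + 1) :
    Computes (K := K) M w (parseConfig .source pre n p g 0)
      (parseConfig .source (pre ++ transitionListCode Δ) n p g 0) := by
  induction Δ generalizing pre with
  | nil => simpa [transitionListCode] using Computes.refl _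
  | cons t Δ ih =>
    rw [transitionListCode_cons] at hw ⊢
    have h1 := computes_parse_block (M := M) (w := w) (K := K) (p := p) (p' := p) (g := g) (g' := g)
      .sourceTick .sourceComma (fun _ _ _ => rfl) (fun _ _ _ => rfl)
      (pre := pre) (k := t.1)
      (rest := .label t.2.1 :: (unaryCode t.2.2 ++ transitionListCode Δ) ++ rest)
      (by simp [hw]) (hΔ t (by simp)).1 hle hle.2
    have h2 := computes_parse_letter (M := M) (w := w) (K := K) (n := n) (n' := n) (p := p) (p' := p)
      (g := g) (g' := g) (c := 0) (c' := 0) (.label (a := t.2.1)) (pre := pre ++ unaryCode t.1)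
      (rest := unaryCode t.2.2 ++ transitionListCode Δ ++ rest) (by simp [hw]) (by simp)
      (forall_updates_holds.2 (by simp [holds_keep, holds_inc, regs]))
      (by simp only [List.length_append]; omega)
    have h3 := computes_parse_block (M := M) (w := w) (K := K) (p := p) (p' := p) (g := g) (g' := g)
      .targetTick .targetComma (fun _ _ _ => rfl) (fun _ _ _ => rfl)
      (pre := pre ++ unaryCode t.1 ++ [.label t.2.1]) (k := t.2.2)
      (rest := transitionListCode Δ ++ rest)
      (by simp [hw]) (hΔ t (by simp)).2 (by simp only [List.length_append]; omega)
      (by simp only [List.length_append]; omega)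
    have h4 := ih (pre := pre ++ unaryCode t.1 ++ [.label t.2.1] ++ unaryCode t.2.2)
      (by simp [hw]) (fun r hr => hΔ r (by simp [hr])) (by simp only [List.length_append]; omega)
    simpa using ((h1.trans h2).trans h3).trans h4

/-- The first phase succeeds on every description. -/
theorem computes_parse (M : OneCounterAutomaton α Q) (D : Description α) {g : Fin D.n}
    (hg : g ∈ D.accept) {ρ : Fin K} (hρ : ρ.val = 0) :
    Computes M D.code (.size, 0, fun _ => 0) (.home M.start ρ, D.code.length + 1,
      regs (D.code.length + 1) D.n D.start g 0 0) := by
  -- The list is split at the accepting state that has to be guessed.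
  obtain ⟨F₁, F₂, hF⟩ := List.append_of_mem hg
  have hF' : D.natAccept = F₁.map Fin.val ++ (g : ℕ) :: F₂.map Fin.val := by
    simp [Description.natAccept, hF]
  have hcode : (stateListCode D.natAccept : List (CodeSymbol α)) =
      stateListCode (F₁.map Fin.val) ++ (unaryCode g ++ stateListCode (F₂.map Fin.val)) := by
    simp [hF', stateListCode]
  have hw : D.code = unaryCode D.n ++ unaryCode D.start ++ (stateListCode (F₁.map Fin.val) ++
      (unaryCode g ++ stateListCode (F₂.map Fin.val))) ++
        .semicolon :: transitionListCode D.natTransitions := by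
    rw [Description.code, Description.head, hcode]
  have hΔ : ∀ t ∈ D.natTransitions, t.1 < D.n ∧ t.2.2 < D.n := by
    intro t ht
    obtain ⟨t, -, rfl⟩ := List.mem_map.1 ht
    exact ⟨t.1.2, t.2.2.2⟩
  have hF₁ : ∀ F : List (Fin D.n), ∀ q ∈ F.map Fin.val, q < D.n := by
    intro F q hq
    obtain ⟨q, -, rfl⟩ := List.mem_map.1 hq
    exact q.2
  -- The first block alone is longer than `D.n`, so after it `pos` exceeds every number of a state.
  have hlen : (unaryCode D.n : List (CodeSymbol α)).length = D.n + 1 := by simp [unaryCode]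
  have hn := D.start.2
  have hgn := g.2
  have h1 := computes_parse_size (M := M) (w := D.code) (K := K) (n := D.n)
    (rest := unaryCode D.start ++ stateListCode (F₁.map Fin.val) ++ unaryCode g ++
      stateListCode (F₂.map Fin.val) ++ .semicolon :: transitionListCode D.natTransitions)
    (by simp [hw])
  have h2 := computes_parse_block (M := M) (w := D.code) (K := K) (n := D.n) (p := 0) (p' := D.start)
    (g := 0) (g' := 0) .startTick .startComma (fun _ _ _ => rfl) (fun _ _ _ => rfl)
    (pre := unaryCode D.n) (k := D.start) (rest := stateListCode (F₁.map Fin.val) ++ unaryCode g ++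
      stateListCode (F₂.map Fin.val) ++ .semicolon :: transitionListCode D.natTransitions)
    (by simp [hw]) hn (by omega) (by omega)
  have h3 := computes_parse_accept (M := M) (w := D.code) (K := K) (n := D.n) (p := D.start) (g := 0)
    (b := false) (F := F₁.map Fin.val) (pre := unaryCode D.n ++ unaryCode D.start)
    (rest := unaryCode g ++ stateListCode (F₂.map Fin.val) ++
      .semicolon :: transitionListCode D.natTransitions)
    (by simp [hw]) (hF₁ _) (by simp only [List.length_append]; omega)
  have h4 := computes_parse_block (M := M) (w := D.code) (K := K) (n := D.n) (p := D.start)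
    (p' := D.start) (g := 0) (g' := g) .acceptTick (.acceptGoal (b := false)) (fun _ _ _ => rfl)
    (fun _ _ _ => rfl)
    (pre := unaryCode D.n ++ unaryCode D.start ++ stateListCode (F₁.map Fin.val)) (k := g)
    (rest := stateListCode (F₂.map Fin.val) ++
      .semicolon :: transitionListCode D.natTransitions)
    (by simp [hw]) hgn (by simp only [List.length_append]; omega)
    (by simp only [List.length_append]; omega)
  have h5 := computes_parse_accept (M := M) (w := D.code) (K := K) (n := D.n) (p := D.start) (g := g)
    (b := true) (F := F₂.map Fin.val)
    (pre := unaryCode D.n ++ unaryCode D.start ++ stateListCode (F₁.map Fin.val) ++ unaryCode g)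
    (rest := .semicolon :: transitionListCode D.natTransitions)
    (by simp [hw]) (hF₁ _) (by simp only [List.length_append]; omega)
  have h6 := computes_parse_letter (M := M) (w := D.code) (K := K) (n := D.n) (n' := D.n)
    (p := D.start) (p' := D.start) (g := g) (g' := g) (c := 0) (c' := 0) .semicolon
    (pre := unaryCode D.n ++ unaryCode D.start ++ stateListCode (F₁.map Fin.val) ++ unaryCode g ++
      stateListCode (F₂.map Fin.val)) (rest := transitionListCode D.natTransitions)
    (by simp [hw]) (by simpa using holds_isZero.2 rfl)
    (forall_updates_holds.2 (by simp [holds_keep, holds_inc, regs]))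
    (by simp only [List.length_append]; omega)
  have h7 := computes_parse_transitions (M := M) (w := D.code) (K := K) (n := D.n) (p := D.start)
    (g := g) (Δ := D.natTransitions)
    (pre := unaryCode D.n ++ unaryCode D.start ++ stateListCode (F₁.map Fin.val) ++ unaryCode g ++
      stateListCode (F₂.map Fin.val) ++ [.semicolon]) (rest := [])
    (by simp [hw]) hΔ (by simp only [List.length_append]; omega)
  have h8 : D.n ≤ D.code.length := by
    rw [hw]
    simp only [List.length_append]
    omega
  have h9 := Computes.of_rule (M := M) (w := D.code) (K := K) (x := D.code.length + 1)
    (y := D.code.length + 1) (y' := D.code.length + 1) (n := D.n) (n' := D.n) (p := D.start)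
    (p' := D.start) (g := g) (g' := g) (c := 0) (c' := 0) (r := 0) (r' := 0) (.finish hρ)
    (At.read_nil (pre := D.code) ⟨by simp, rfl⟩) (by simpa using holds_isZero.2 rfl)
    (forall_updates_holds.2 (by simp [holds_keep, regs])) (by omega) (by omega)
  have h10 : unaryCode D.n ++ unaryCode D.start ++ stateListCode (F₁.map Fin.val) ++ unaryCode g ++
      stateListCode (F₂.map Fin.val) ++ [.semicolon] ++ transitionListCode D.natTransitions =
        D.code := by
    simp [hw]
  rw [h10] at h7
  simp only [HeadMove.apply, min_self] at h9
  exact ((((((h1.trans h2).trans h3).trans h4).trans h5).trans h6).trans h7).trans h9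

/-- A configuration of the second phase, with the head behind `pre`. -/
def simConfig (w : List (CodeSymbol α)) (n g : ℕ) (s : ProgramState Q K) (pre : List (CodeSymbol α))
    (p c r : ℕ) : ProgramState Q K × ℕ × (Reg → ℕ) :=
  (s, pre.length + 1, regs (w.length + 1) n p g c r)

/-! ### Runs of the program that simulate the product -/

section Simulation

variable {n g : ℕ}

theorem computes_sim_letter {s s' : ProgramState Q K} {a : CodeSymbol α}
    {ts : List (Constraint Reg)} {f : Reg → Update} {pre rest : List (CodeSymbol α)}
    {p p' c c' r r' : ℕ} (hn : n ≤ w.length + 1 ∧ g ≤ w.length + 1)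
    (hr : Rule M s (.letter a) s' .right ts f)
    (hw : w = pre ++ a :: rest)
    (hts : ∀ t ∈ ts, t.holds (regs (w.length + 1) n p g c r) (regs (w.length + 1) n p' g c' r'))
    (hf : ∀ i, (f i).holds i (regs (w.length + 1) n p g c r) (regs (w.length + 1) n p' g c' r'))
    (hle : p' ≤ w.length + 1 ∧ c' ≤ w.length + 1 ∧ r' ≤ w.length + 1) :
    Computes M w (simConfig w n g s pre p c r) (simConfig w n g s' (pre ++ [a]) p' c' r') := by
  have := Computes.of_rule (w := w) (x := pre.length + 1) hr (by rw [hw, readInput_append]) hts hf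
    ⟨hn.1, hle.1, hn.2, hle.2.1, hle.2.2⟩ (by omega)
  have h1 : min (HeadMove.right.apply (pre.length + 1)) (w.length + 1) = (pre ++ [a]).length + 1 := by
    simp [hw, HeadMove.apply]
  rw [h1] at this
  exact this

theorem computes_sim_ticks {s : ProgramState Q K} {pre rest : List (CodeSymbol α)} {p c r k : ℕ}
    (hn : n ≤ w.length + 1 ∧ g ≤ w.length + 1)
    (hs : Rule M s (.letter .tick) s .right [] (updates .keep .keep .keep .keep .inc .keep))
    (hw : w = pre ++ List.replicate k .tick ++ rest)
    (hle : p ≤ w.length + 1 ∧ c ≤ pre.length + 1 ∧ r ≤ w.length + 1) :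
    Computes M w (simConfig w n g s pre p c r)
      (simConfig w n g s (pre ++ List.replicate k .tick) p (c + k) r) := by
  induction k generalizing rest with
  | zero => simpa using Computes.refl _
  | succ k ih =>
    rw [List.replicate_succ'] at hw
    refine (ih (rest := .tick :: rest) (by simp [hw])).trans ?_
    -- The ticks counted are letters of `w`, which keeps `count` below `pos`.
    have hlen := congrArg List.length hw
    simp only [List.length_append, List.length_replicate, List.length_singleton] at hlen
    have := computes_sim_letter (M := M) (w := w) (p := p) (p' := p) (c := c + k)
      (c' := c + k + 1) (r := r) (r' := r) hn hs (pre := pre ++ List.replicate k .tick)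
      (rest := rest) (by simp [hw]) (by simp)
      (forall_updates_holds.2 (by simp [holds_keep, holds_inc, regs])) (by omega)
    simpa [List.replicate_succ', add_assoc] using this

theorem computes_sim_skip_block {q : Q} {ρ : Fin K} {pre rest : List (CodeSymbol α)} {p r k : ℕ}
    (hn : n ≤ w.length + 1 ∧ g ≤ w.length + 1) (hw : w = pre ++ unaryCode k ++ rest)
    (hle : p ≤ w.length + 1 ∧ r ≤ w.length + 1) :
    Computes M w (simConfig w n g (.skip q ρ) pre p 0 r)
      (simConfig w n g (.find q ρ) (pre ++ unaryCode k) p 0 r) := by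
  have h1 : ∀ k rest, w = pre ++ List.replicate k .tick ++ rest →
      Computes M w (simConfig w n g (.skip q ρ) pre p 0 r)
        (simConfig w n g (.skip q ρ) (pre ++ List.replicate k .tick) p 0 r) := by
    intro k
    induction k with
    | zero => exact fun _ _ => by simpa using Computes.refl _
    | succ k ih =>
      intro rest hw
      rw [List.replicate_succ'] at hw
      refine (ih (.tick :: rest) (by simp [hw])).trans ?_
      have := computes_sim_letter (M := M) (w := w) (p := p) (p' := p) (c := 0) (c' := 0) (r := r)
        (r' := r) hn (.skipTick (q := q) (ρ := ρ)) (pre := pre ++ List.replicate k .tick)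
        (rest := rest) (by simp [hw]) (by simp)
        (forall_updates_holds.2 (by simp [holds_keep, regs])) (by omega)
      simpa [List.replicate_succ'] using this
  have h2 := computes_sim_letter (M := M) (w := w) (p := p) (p' := p) (c := 0) (c' := 0) (r := r)
    (r' := r) hn (.skipComma (q := q) (ρ := ρ)) (pre := pre ++ List.replicate k .tick)
    (rest := rest) (by simp [hw, unaryCode_eq]) (by simp)
    (forall_updates_holds.2 (by simp [holds_keep, regs])) (by omega)
  simpa [unaryCode_eq] using (h1 k (.comma :: rest) (by simp [hw, unaryCode_eq])).trans h2

theorem computes_sim_skip {q : Q} {ρ : Fin K} {Δ : List (ℕ × Option α × ℕ)}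
    {pre rest : List (CodeSymbol α)} {p r : ℕ} (hn : n ≤ w.length + 1 ∧ g ≤ w.length + 1)
    (hw : w = pre ++ transitionListCode Δ ++ rest) (hle : p ≤ w.length + 1 ∧ r ≤ w.length + 1) :
    Computes M w (simConfig w n g (.find q ρ) pre p 0 r)
      (simConfig w n g (.find q ρ) (pre ++ transitionListCode Δ) p 0 r) := by
  induction Δ generalizing pre with
  | nil => simpa [transitionListCode] using Computes.refl _
  | cons t Δ ih =>
    rw [transitionListCode_cons] at hw ⊢
    have h1 := computes_sim_ticks (M := M) (w := w) (p := p) (c := 0) (r := r) (k := t.1) hn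
      (.findTick (q := q) (ρ := ρ)) (pre := pre)
      (rest := .comma :: .label t.2.1 :: (unaryCode t.2.2 ++ transitionListCode Δ ++ rest))
      (by simp [hw, unaryCode_eq]) (by omega)
    have h2 := computes_sim_letter (M := M) (w := w) (p := p) (p' := p) (c := 0 + t.1) (c' := 0)
      (r := r) (r' := r) hn (.findOther (q := q) (ρ := ρ)) (pre := pre ++ List.replicate t.1 .tick)
      (rest := .label t.2.1 :: (unaryCode t.2.2 ++ transitionListCode Δ ++ rest))
      (by simp [hw, unaryCode_eq]) (by simp)
      (forall_updates_holds.2 (by simp [holds_keep, holds_zero, regs])) (by omega)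
    have h3 := computes_sim_letter (M := M) (w := w) (p := p) (p' := p) (c := 0) (c' := 0)
      (r := r) (r' := r) hn (.skipLabel (q := q) (ρ := ρ) (a := t.2.1))
      (pre := pre ++ List.replicate t.1 .tick ++ [.comma])
      (rest := unaryCode t.2.2 ++ transitionListCode Δ ++ rest)
      (by simp [hw, unaryCode_eq]) (by simp)
      (forall_updates_holds.2 (by simp [holds_keep, regs])) (by omega)
    have h4 := computes_sim_skip_block (M := M) (w := w) (q := q) (ρ := ρ) hn
      (pre := pre ++ List.replicate t.1 .tick ++ [.comma] ++ [.label t.2.1]) (k := t.2.2)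
      (rest := transitionListCode Δ ++ rest) (by simp [hw, unaryCode_eq]) hle
    have h5 := ih (pre := pre ++ List.replicate t.1 .tick ++ [.comma] ++ [.label t.2.1] ++
      unaryCode t.2.2) (by simp [hw, unaryCode_eq])
    simpa [unaryCode_eq] using (((h1.trans h2).trans h3).trans h4).trans h5

theorem computes_sim_rewind {q : Q} {ρ : Fin K} {pre rest : List (CodeSymbol α)} {p r x : ℕ}
    (hn : n ≤ w.length + 1 ∧ g ≤ w.length + 1) (hw : w = pre ++ .semicolon :: rest)
    (h1 : .semicolon ∉ pre) (h2 : .semicolon ∉ rest)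
    (hle : p ≤ w.length + 1 ∧ r ≤ w.length + 1) (hx : pre.length + 1 ≤ x) (hx' : x ≤ w.length + 1) :
    Computes M w (.home q ρ, x, regs (w.length + 1) n p g 0 r)
      (simConfig w n g (.home q ρ) pre p 0 r) := by
  induction x, hx using Nat.le_induction with
  | base => exact .refl _
  | succ x hx ih =>
    refine .trans ?_ (ih (by omega))
    have := Computes.of_rule (M := M) (w := w) (K := K) (x := x + 1) (y := w.length + 1)
      (y' := w.length + 1) (n := n) (n' := n) (p := p) (p' := p) (g := g) (g' := g) (c := 0)
      (c' := 0) (r := r) (r' := r) (.rewind (q := q) (ρ := ρ) ?_) rfl (by simp)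
      (forall_updates_holds.2 (by simp [holds_keep, regs])) (by omega) (by omega)
    · have h3 : min (HeadMove.left.apply (x + 1)) (w.length + 1) = x := by
        simp only [HeadMove.apply]
        omega
      rwa [h3] at this
    -- A semicolon at `x + 1` would be the unique one, just behind `pre`; but the head is further to
    -- the right.
    · intro h
      obtain ⟨pre', rest', h3, h4⟩ := exists_at_of_readInput h
      obtain ⟨rfl, -⟩ := (List.append_cons_inj_of_notMem h1 h2).1 (hw.symm.trans h3)
      omega

/-- A transition of the finite automaton, up to the label. -/
theorem computes_sim_find {q : Q} {ρ : Fin K} {D : Description α} {p p' : Fin D.n} {a : Option α}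
    {r x : ℕ} (hg : g ≤ D.code.length + 1) (ht : (p, a, p') ∈ D.transitions)
    (hr : r ≤ D.code.length + 1)
    (hx : D.head.length + 1 ≤ x) (hx' : x ≤ D.code.length + 1) :
    ∃ pre rest, D.code = pre ++ .label a :: (unaryCode p' ++ rest) ∧ D.head.length ≤ pre.length ∧
      Computes M D.code (.home q ρ, x, regs (D.code.length + 1) D.n p g 0 r)
        (simConfig D.code D.n g (.read q ρ) pre p 0 r) := by
  have hlen : D.n + 1 ≤ D.head.length := by
    simp [Description.head, unaryCode]
  have hlen' : D.head.length ≤ D.code.length := by simp [Description.code]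
  have hn : D.n ≤ D.code.length + 1 ∧ g ≤ D.code.length + 1 := by omega
  have hp := p.2
  obtain ⟨Δ₁, Δ₂, hΔ⟩ := List.append_of_mem (List.mem_map.2 ⟨_, ht, rfl⟩ :
    ((p : ℕ), a, (p' : ℕ)) ∈ D.natTransitions)
  replace hΔ : D.natTransitions = _ := hΔ
  have hw : D.code = D.head ++ .semicolon :: (transitionListCode Δ₁ ++ (unaryCode p ++
      .label a :: (unaryCode p' ++ transitionListCode Δ₂))) := by
    simp [Description.code, hΔ, transitionListCode]
  refine ⟨D.head ++ [.semicolon] ++ transitionListCode Δ₁ ++ unaryCode p, transitionListCode Δ₂,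
    by simp [hw], by simp only [List.length_append]; omega, ?_⟩
  have h1 := computes_sim_rewind (M := M) (q := q) (ρ := ρ) (p := p) (r := r) hn
    (rfl : D.code = D.head ++ _) D.semicolon_notMem_head (semicolon_notMem_transitionListCode _)
    (by omega) hx hx'
  have h2 := computes_sim_letter (M := M) (w := D.code) (p := p) (p' := p) (c := 0) (c' := 0)
    (r := r) (r' := r) hn (.enter (q := q) (ρ := ρ)) (pre := D.head) hw (by simp)
    (forall_updates_holds.2 (by simp [holds_keep, regs])) (by omega)
  have h3 := computes_sim_skip (M := M) (w := D.code) (q := q) (ρ := ρ) (p := p) (r := r) (Δ := Δ₁)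
    hn (pre := D.head ++ [.semicolon])
    (rest := unaryCode p ++ .label a :: (unaryCode p' ++ transitionListCode Δ₂)) (by simp [hw])
    (by omega)
  have h4 := computes_sim_ticks (M := M) (w := D.code) (p := p) (c := 0) (r := r) (k := p) hn
    (.findTick (q := q) (ρ := ρ)) (pre := D.head ++ [.semicolon] ++ transitionListCode Δ₁)
    (rest := .comma :: .label a :: (unaryCode p' ++ transitionListCode Δ₂))
    (by simp [hw, unaryCode_eq]) (by omega)
  have h5 := computes_sim_letter (M := M) (w := D.code) (p := p) (p' := p) (c := 0 + p) (c' := 0)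
    (r := r) (r' := r) hn (.found (q := q) (ρ := ρ))
    (pre := D.head ++ [.semicolon] ++ transitionListCode Δ₁ ++ List.replicate p .tick)
    (rest := .label a :: (unaryCode p' ++ transitionListCode Δ₂)) (by simp [hw, unaryCode_eq])
    (by simpa using holds_isEq.2 (by simp [regs]))
    (forall_updates_holds.2 (by simp [holds_keep, holds_zero, regs])) (by omega)
  simpa [unaryCode_eq] using (((h1.trans h2).trans h3).trans h4).trans h5

/-- A transition of the finite automaton, from the target on. -/
theorem computes_sim_move {q : Q} {ρ : Fin K} {pre rest : List (CodeSymbol α)} {p r k : ℕ}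
    (hn : n ≤ w.length + 1 ∧ g ≤ w.length + 1) (hw : w = pre ++ unaryCode k ++ rest)
    (hle : p ≤ w.length + 1 ∧ r ≤ w.length + 1) :
    Computes M w (simConfig w n g (.move q ρ) pre p 0 r)
      (simConfig w n g (.home q ρ) (pre ++ unaryCode k) k 0 r) := by
  have h1 := computes_sim_ticks (M := M) (w := w) (p := p) (c := 0) (r := r) (k := k) hn
    (.moveTick (q := q) (ρ := ρ)) (pre := pre) (rest := .comma :: rest)
    (by simp [hw, unaryCode_eq]) (by omega)
  have hlen := congrArg List.length hw
  simp only [List.length_append, unaryCode_eq, List.length_replicate] at hlen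
  have h2 := computes_sim_letter (M := M) (w := w) (p := p) (p' := k) (c := 0 + k) (c' := 0)
    (r := r) (r' := r) hn (.moveComma (q := q) (ρ := ρ)) (pre := pre ++ List.replicate k .tick)
    (rest := rest) (by simp [hw, unaryCode_eq]) (by simp)
    (forall_updates_holds.2 (by simp [holds_keep, holds_zero, holds_copy, regs])) (by omega)
  simpa [unaryCode_eq] using h1.trans h2

/-- The program simulates a step of the product. -/
theorem computes_sim_step {D : Description α} {B : ℕ} {c c' : (Fin D.n × Q) × ℕ}
    (h : BoundedCounterStep (ProductStep D.toNFA M) B c c') (hB : B ≤ K * (D.code.length + 1))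
    (hc : c.2 ≤ B) (hK : 0 < K) (hg : g ≤ D.code.length + 1) {x : ℕ}
    (hx : D.head.length + 1 ≤ x) (hx' : x ≤ D.code.length + 1) :
    ∃ x', D.head.length + 1 ≤ x' ∧ x' ≤ D.code.length + 1 ∧
      Computes M D.code
        (.home c.1.2 ⟨c.2 % K, Nat.mod_lt _ hK⟩, x,
          regs (D.code.length + 1) D.n c.1.1 g 0 (c.2 / K))
        (.home c'.1.2 ⟨c'.2 % K, Nat.mod_lt _ hK⟩, x',
          regs (D.code.length + 1) D.n c'.1.1 g 0 (c'.2 / K)) := by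
  obtain ⟨⟨p, q⟩, m⟩ := c
  obtain ⟨⟨p', q'⟩, m'⟩ := c'
  obtain ⟨⟨d, hd, hm⟩, hm'⟩ := h
  simp only at hd hm hm' hc ⊢
  have hlen : D.n + 1 ≤ D.head.length := by
    simp [Description.head, unaryCode]
  have hlen' : D.head.length ≤ D.code.length := by simp [Description.code]
  have hn : D.n ≤ D.code.length + 1 ∧ g ≤ D.code.length + 1 := by omega
  -- The division by `K` brings the linearly bounded counter below `pos`, as bounded steps require.
  have hr : m / K ≤ D.code.length + 1 := Nat.div_le_of_le_mul (hc.trans hB)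
  have hr' : m' / K ≤ D.code.length + 1 := Nat.div_le_of_le_mul (hm'.trans hB)
  have hp := p.2
  have hp' := p'.2
  cases hd with
  | eps hs =>
    obtain rfl : m' = m := by simpa using hm
    obtain ⟨pre, rest, hw, hpre, h1⟩ :=
      computes_sim_find (M := M) (q := q) (ρ := ⟨m' % K, Nat.mod_lt _ hK⟩) hg hs hr hx hx'
    have h2 := computes_sim_letter (M := M) (w := D.code) (p := p) (p' := p) (c := 0) (c' := 0)
      (r := m' / K) (r' := m' / K) hn (.readEps (q := q) (ρ := ⟨m' % K, Nat.mod_lt _ hK⟩)) hw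
      (by simp) (forall_updates_holds.2 (by simp [holds_keep, regs])) (by omega)
    have h3 := computes_sim_move (M := M) (w := D.code) (q := q) (ρ := ⟨m' % K, Nat.mod_lt _ hK⟩)
      (p := p) (r := m' / K) hn (pre := pre ++ [.label none]) (k := p') (rest := rest)
      (by simp [hw]) (by omega)
    refine ⟨_, ?_, ?_, (h1.trans h2).trans h3⟩
    · simp only [List.length_append]
      omega
    · rw [hw]
      simp
  | silent hs =>
    let v := regs (D.code.length + 1) D.n p g 0 (m / K)
    let v' := regs (D.code.length + 1) D.n p g 0 (m' / K)
    have hv : m = K * v .ctr + m % K := (Nat.div_add_mod m K).symm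
    have hv' : m' = K * v' .ctr + m' % K := (Nat.div_add_mod m' K).symm
    obtain ⟨ts, h1, h2⟩ := ZeroTest.exists_of_eq_decide (ρ := ⟨m % K, Nat.mod_lt _ hK⟩) (v := v)
      (v' := v') hv
    obtain ⟨u, h3, h4⟩ := CounterUpdate.exists_of_counter_eq (ρ := ⟨m % K, Nat.mod_lt _ hK⟩)
      (ρ' := ⟨m' % K, Nat.mod_lt _ hK⟩) (d := d) (v := v) (v' := v') (by
        simp only
        rw [← hv, ← hv', hm])
    have h5 := Computes.of_rule (M := M) (w := D.code) (x := x) (.silent hs h1 h3) rfl h2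
      (forall_updates_holds.2 ⟨rfl, rfl, rfl, rfl, rfl, h4⟩) (by omega) (by omega)
    refine ⟨x, hx, hx', ?_⟩
    simpa [HeadMove.apply, hx'] using h5
  | @read _ _ _ _ _ _ a hs hs' =>
    let v := regs (D.code.length + 1) D.n p g 0 (m / K)
    let v' := regs (D.code.length + 1) D.n p g 0 (m' / K)
    have hv : m = K * v .ctr + m % K := (Nat.div_add_mod m K).symm
    have hv' : m' = K * v' .ctr + m' % K := (Nat.div_add_mod m' K).symm
    obtain ⟨ts, h1, h2⟩ := ZeroTest.exists_of_eq_decide (ρ := ⟨m % K, Nat.mod_lt _ hK⟩) (v := v)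
      (v' := v') hv
    obtain ⟨u, h3, h4⟩ := CounterUpdate.exists_of_counter_eq (ρ := ⟨m % K, Nat.mod_lt _ hK⟩)
      (ρ' := ⟨m' % K, Nat.mod_lt _ hK⟩) (d := d) (v := v) (v' := v') (by
        simp only
        rw [← hv, ← hv', hm])
    obtain ⟨pre, rest, hw, hpre, h5⟩ :=
      computes_sim_find (M := M) (q := q) (ρ := ⟨m % K, Nat.mod_lt _ hK⟩) hg hs hr hx hx'
    have h6 := computes_sim_letter (M := M) (w := D.code) hn (.readLetter hs' h1 h3) hw h2
      (forall_updates_holds.2 ⟨rfl, rfl, rfl, rfl, rfl, h4⟩) (by omega)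
    have h7 := computes_sim_move (M := M) (w := D.code) (q := q')
      (ρ := ⟨m' % K, Nat.mod_lt _ hK⟩) (p := p) (r := m' / K) hn (pre := pre ++ [.label (some a)])
      (k := p') (rest := rest) (by simp [hw]) (by omega)
    refine ⟨_, ?_, ?_, (h5.trans h6).trans h7⟩
    · simp only [List.length_append]
      omega
    · rw [hw]
      simp

end Simulation

/-- The program accepts all descriptions in the regular realizability problem. -/
theorem exists_computes_of_mem_NRR [Fintype Q] (hK : K = 4 * Fintype.card Q ^ 2 + 3)
    (hw : w ∈ NRR M.accepts) :
    ∃ x v, Computes (K := K) M w (.size, 0, fun _ => 0) (.done, x, v) := by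
  obtain ⟨D, rfl, p, hp, q, hq, m, h⟩ := Description.exists_bounded_reach hw
  rw [← hK] at h
  have hK' : 0 < K := by omega
  have hlen : D.n + 1 ≤ D.head.length := by
    simp [Description.head, unaryCode]
  have hlen' : D.head.length ≤ D.code.length := by simp [Description.code]
  have hp' := p.2
  -- Besides the counter bound, the induction keeps the head to the right of the first part of the
  -- code, so that moving left reaches the semicolon.
  have key : ∀ {c : (Fin D.n × Q) × ℕ}, ReflTransGen (BoundedCounterStep (ProductStep D.toNFA M)
      (K * (D.code.length + 1))) ((D.start, M.start), 0) c → c.2 ≤ K * (D.code.length + 1) ∧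
      ∃ x, D.head.length + 1 ≤ x ∧ x ≤ D.code.length + 1 ∧
        Computes M D.code (.size, 0, fun _ => 0) (.home c.1.2 ⟨c.2 % K, Nat.mod_lt _ hK'⟩, x,
          regs (D.code.length + 1) D.n c.1.1 p 0 (c.2 / K)) := by
    intro c hc
    induction hc with
    | refl =>
      refine ⟨by simp, D.code.length + 1, by omega, le_rfl, ?_⟩
      simpa using computes_parse M D hp (ρ := ⟨0 % K, Nat.mod_lt _ hK'⟩) (by simp)
    | tail _ h ih =>
      obtain ⟨h1, x, h2, h3, h4⟩ := ih
      obtain ⟨x', h5, h6, h7⟩ := computes_sim_step (g := p) h le_rfl h1 hK' (by omega) h2 h3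
      exact ⟨h.2, x', h5, h6, h4.trans h7⟩
  obtain ⟨hm, x, -, -, h1⟩ := key h
  have hr : m / K ≤ D.code.length + 1 := Nat.div_le_of_le_mul hm
  exact ⟨_, _, h1.trans (Computes.of_rule (y' := D.code.length + 1) (n' := D.n) (p' := p) (g' := p)
    (c' := 0) (r' := m / K) (.halt hq) rfl (List.forall_mem_singleton.2 (holds_isEq.2 rfl))
    (forall_updates_holds.2 (by simp [holds_keep, regs])) (by omega) (by omega))⟩

end Program

theorem mainTheorem7 {α : Type u} [Finite α] {Q : Type v} [Finite Q]
    (M : OneCounterAutomaton α Q) (L : Language α) (hL : M.accepts = L) :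
    InNL (NRR L) := by
  -- `InNL` asks for machine states in `Type`, whereas `Q` may live in any universe; so the states
  -- are replaced by `Fin k`.
  obtain ⟨k, ⟨e⟩⟩ := Finite.exists_equiv_fin Q
  rw [← hL, ← M.accepts_rename e]
  refine (program (M.rename e) (4 * Fintype.card (Fin k) ^ 2 + 3)).inNL .pos _
    (fun w c c' h => pos_le_of_program_step h) (fun w c h => (inv_of_reachable h).pos_le)
    (fun w c h hc => ?_) (fun w hw => ?_)
  · have := inv_of_reachable h
    rw [Set.mem_singleton_iff.1 hc] at this
    exact this.1
  · obtain ⟨x, v, h⟩ := exists_computes_of_mem_NRR rfl hw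
    exact ⟨(.done, x, v), rfl, h⟩
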